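/- For $a,b\in\mathbb C$ let $f_{a,b}(z)=z^3-3a^2z+2a^3+b$, a monic cubic polynomial with critical points $\pm a$, marked critical point $a$, and $f_{a,b}(a)=b$. Let $\mathcal M_3=\mathbb C^2/\bigl((a,b)\sim(-a,-b)\bigr)$ be the moduli space of cubic polynomials with a marked critical point, regarded as an affine variety through the embedding into $\mathbb C^3$ induced by $(a,b)\mapsto(a^2,ab,b^2)$, and let $\pi:\mathbb C^2\to\mathcal M_3$ be the quotient map. A point $x$ is strictly $(k,n)$-preperiodic under a map $f$ if $f^{k+n}(x)=f^k(x)$ and $f^{l+m}(x)\ne f^l(x)$ for all $0\le l\le k$, $1\le m\le n$ with $(l,m)\neq(k,n)$. For $k\ge 0$, $n\ge 1$ let $\Sigma_{k,n}\subset\mathcal M_3$ be the Zariski closure of the set of points $\pi(a,b)$ for which $a$ is strictly $(k,n)$-preperiodic under $f_{a,b}$. Let $f_{k,n}=f_{a,b}^{k+n}(a)-f_{a,b}^{k}(a)\in\mathbb Z[a,b]$, and let $h_{k,n}=f_{k,n}/\prod_i g_i^{\alpha_i}$, where $g_i$ runs over the distinct irreducible factors in $\mathbb Z[a,b]$, normalised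 to be monic in $b$, of the polynomials $f_{l,m}$ with $0\le l\le k$, $m\ge 1$, $m\mid n$, $(l,m)\ne(k,n)$, and $\alpha_i$ is the exponent of the highest power of $g_i$ dividing $f_{k,n}$. **Theorem.** For every integer $k\ge 0$, $\Sigma_{k,2}$ is an irreducible curve in $\mathcal M_3$ (it is irreducible and of dimension $1$). Moreover, either $h_{k,2}$ is irreducible in $\mathbb C[a,b]$, or there is a polynomial $t\in\mathbb Q(i)[a,b]$ such that $t$ and its complex conjugate $\bar t$ (obtained by conjugating the coefficients) are irreducible in $\mathbb C[a,b]$, $h_{k,2}=t\,\bar t$, $t(-a,-b)=\bar t(a,b)$, and the curves $\{t=0\}$ and $\{\bar t=0\}$ in $\mathbb C^2$ have the same image in $\mathcal M_3$, namely $\Sigma_{k,2}$. -/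

import Mathlib

open Polynomial
open scoped Polynomial.Bivariate

noncomputable section

namespace CubicModuli

/-! ## Preperiodic points and cubic polynomials with a marked critical point -/

/-- `x` is strictly `(k, n)`-preperiodic under `f`: `f^{k+n}(x) = f^k(x)`, and `f^{l+m}(x) ≠ f^l(x)`
for all `0 ≤ l ≤ k` and `1 ≤ m ≤ n` with `(l, m) ≠ (k, n)`. -/
def IsStrictlyPreperiodic {α : Type*} (f : α → α) (k n : ℕ) (x : α) : Prop :=
  f^[k + n] x = f^[k] x ∧
    ∀ l m : ℕ, l ≤ k → 1 ≤ m → m ≤ n → (l, m) ≠ (k, n) → f^[l + m] x ≠ f^[l] x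

/-- The monic reduced cubic `f_{a,b}(z) = z³ - 3a²z + 2a³ + b`, with critical points `±a`, marked
critical point `a`, and critical value `f_{a,b}(a) = b`. -/
def cubicMap (a b z : ℂ) : ℂ := z ^ 3 - 3 * a ^ 2 * z + 2 * a ^ 3 + b

/-! ## The moduli space `ℂ² / ((a, b) ∼ (-a, -b))` and its Zariski topology -/

/-- The equivalence relation `(a, b) ∼ (-a, -b)` on `ℂ²`. -/
def negSetoid : Setoid (ℂ × ℂ) where
  r p q := p = q ∨ p = -q
  iseqv :=
    { refl := fun _ => Or.inl rfl
      symm := by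
        rintro p q (rfl | rfl)
        · exact Or.inl rfl
        · exact Or.inr (neg_neg q).symm
      trans := by
        rintro p q r (rfl | rfl) (rfl | rfl)
        · exact Or.inl rfl
        · exact Or.inr rfl
        · exact Or.inr rfl
        · exact Or.inl (neg_neg r) }

/-- The moduli space of cubic polynomials with a marked critical point,
`M₃ = ℂ² / ((a, b) ∼ (-a, -b))`. -/
def M3 : Type := Quotient negSetoid

/-- The quotient map `ℂ² → M₃`. -/
def toM3 (p : ℂ × ℂ) : M3 := Quotient.mk negSetoid p

/-- The embedding `M₃ → ℂ³` induced by the affine Veronese map `(a, b) ↦ (a², ab, b²)`; it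
identifies `M₃` with an affine variety. -/
def veronese : M3 → (Fin 3 → ℂ) :=
  Quotient.lift (fun p : ℂ × ℂ => ![p.1 ^ 2, p.1 * p.2, p.2 ^ 2]) (by
    rintro p q (rfl | rfl)
    · rfl
    · simp)

/-- The Zariski topology on affine space `ℂ^n`: the closed sets are the zero loci of ideals of
`ℂ[x₁, …, xₙ]`. -/
@[reducible]
def zariskiTopology (n : ℕ) : TopologicalSpace (Fin n → ℂ) :=
  TopologicalSpace.ofClosed
    {Z | ∃ I : Ideal (MvPolynomial (Fin n) ℂ), Z = MvPolynomial.zeroLocus ℂ I}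
    ⟨⊤, by simp⟩
    (by
      intro A hA
      refine ⟨⨆ I ∈ {I : Ideal (MvPolynomial (Fin n) ℂ) | MvPolynomial.zeroLocus ℂ I ∈ A}, I, ?_⟩
      apply Set.Subset.antisymm
      · intro x hx
        have h : (⨆ I ∈ {I : Ideal (MvPolynomial (Fin n) ℂ) | MvPolynomial.zeroLocus ℂ I ∈ A}, I)
            ≤ MvPolynomial.vanishingIdeal ℂ {x} := by
          refine iSup₂_le fun I hI p hp => ?_
          rintro y rfl
          exact hx _ hI p hp
        intro p hp
        exact h hp x rfl
      · intro x hx Z hZ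
        obtain ⟨I, rfl⟩ := hA hZ
        exact fun p hp => hx p ((le_iSup₂_of_le (f := fun (I : Ideal (MvPolynomial (Fin n) ℂ))
          (_ : I ∈ {I : Ideal (MvPolynomial (Fin n) ℂ) | MvPolynomial.zeroLocus ℂ I ∈ A}) => I)
          I hZ le_rfl) hp))
    (by
      rintro _ ⟨I, rfl⟩ _ ⟨J, rfl⟩
      refine ⟨I * J, ?_⟩
      ext x
      constructor
      · intro hx p hp
        have hle : I * J ≤ MvPolynomial.vanishingIdeal ℂ {x} := by
          refine Ideal.mul_le.2 fun r hr s hs => ?_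
          rintro y rfl
          rcases hx with hx | hx
          · rw [map_mul, hx r hr, zero_mul]
          · rw [map_mul, hx s hs, mul_zero]
        exact hle hp x rfl
      · intro hx
        by_contra hcon
        simp only [Set.mem_union, not_or, MvPolynomial.mem_zeroLocus_iff, not_forall] at hcon
        obtain ⟨⟨p, hp, hp0⟩, q, hq, hq0⟩ := hcon
        have := hx (p * q) (Ideal.mul_mem_mul hp hq)
        rw [map_mul] at this
        exact (mul_ne_zero hp0 hq0) this)

/-- The Zariski topology on `M₃`, as a subvariety of `ℂ³`. -/
instance : TopologicalSpace M3 := TopologicalSpace.induced veronese (zariskiTopology 3)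

/-- The set of points of `M₃` for which the marked critical point `a` is strictly
`(k, n)`-preperiodic under `f_{a,b}`. -/
def strictLocus (k n : ℕ) : Set M3 :=
  toM3 '' {p : ℂ × ℂ | IsStrictlyPreperiodic (cubicMap p.1 p.2) k n p.1}

/-- `Σ_{k,n}`: the Zariski closure in `M₃` of the strictly `(k, n)`-preperiodic locus. -/
def SigmaCurve (k n : ℕ) : Set M3 := closure (strictLocus k n)

/-! ## The polynomials `f_{k,n}` and `h_{k,n}`

A polynomial in `R[a, b]` is an element of `R[X][Y]`, with `a = C X` and `b = Y`; "monic" means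
monic as a polynomial in `b` over `R[a]`. -/

/-- The polynomial `f^m(a) ∈ ℤ[a, b]`, where `f(z) = z³ - 3a²z + 2a³ + b`. -/
def critIter : ℕ → ℤ[X][Y]
  | 0 => C X
  | m + 1 => critIter m ^ 3 - 3 * C X ^ 2 * critIter m + 2 * C X ^ 3 + Y

/-- `f_{k,n} = f^{k+n}(a) - f^k(a) ∈ ℤ[a, b]`. -/
def fPoly (k n : ℕ) : ℤ[X][Y] := critIter (k + n) - critIter k

/-- The irreducible factors `g` in `ℤ[a, b]` of the polynomials `f_{l,m}` with `0 ≤ l ≤ k`, `1 ≤ m`,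
`m ∣ n`, `(l, m) ≠ (k, n)`. As `f_{l,m}` is monic in `b`, each irreducible factor is up to sign
monic in `b`, and we take the monic one. -/
def lowerFactors (k n : ℕ) : Set ℤ[X][Y] :=
  {g | Irreducible g ∧ g.Monic ∧
    ∃ l m : ℕ, l ≤ k ∧ 1 ≤ m ∧ m ∣ n ∧ (l, m) ≠ (k, n) ∧ g ∣ fPoly l m}

/-- `∏ᵢ gᵢ^{αᵢ}`, over the finite set of the factors `gᵢ` above (for `n ≥ 1`), where `αᵢ` is the
highest power of `gᵢ` that divides `f_{k,n}`. -/
def lowerPart (k n : ℕ) : ℤ[X][Y] :=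
  ∏ᶠ g ∈ lowerFactors k n, g ^ multiplicity g (fPoly k n)

/-- `h_{k,n} = f_{k,n} / ∏ᵢ gᵢ^{αᵢ}`; the divisor is monic in `b` and the division is exact. -/
def hPoly (k n : ℕ) : ℤ[X][Y] := fPoly k n /ₘ lowerPart k n

/-! ## Polynomials in `ℂ[a, b]` and their curves -/

/-- `h_{k,n}` as an element of `ℂ[a, b]`. -/
def hPolyC (k n : ℕ) : ℂ[X][Y] := (hPoly k n).map (mapRingHom (Int.castRingHom ℂ))

/-- The polynomial `t(-a, -b)`. -/
def negArgs (t : ℂ[X][Y]) : ℂ[X][Y] := (t.map (compRingHom (-X))).comp (-(Y : ℂ[X][Y]))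

/-- The polynomial whose coefficients are the complex conjugates of those of `t`. -/
def conjPoly (t : ℂ[X][Y]) : ℂ[X][Y] := t.map (mapRingHom (starRingEnd ℂ))

/-- All coefficients of `t` lie in `ℚ(i)`. -/
def HasGaussianCoeffs (t : ℂ[X][Y]) : Prop :=
  ∀ i j : ℕ, ∃ p q : ℚ, (t.coeff j).coeff i = (p : ℂ) + (q : ℂ) * Complex.I

/-- The algebraic set of `t` in `ℂ²`. -/
def zeroSet (t : ℂ[X][Y]) : Set (ℂ × ℂ) := {p | t.evalEval p.1 p.2 = 0}

end CubicModuli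

end

/-!
Write `u = b - a` and let `c_m = f^m(a)` be the critical orbit. Factoring `f(x) - f(y)` gives
`f_{k,2} = f_{k,1} G_k` (`fPoly_two`) and `G_{k+1} = G_k R_k` with an explicit `R_k`
(`perTwoQuot_succ`). For `k ≠ 1` the factor `H = h_{k,2}` is `G_0`, or `R_{k-1}`, or, for odd `k`,
the quotient `R_{k-1} / G_0` (`exists_isCore`); for `k = 1` it is `u² + 1`, which is dealt with
directly.

Two facts determine how `H` factors.
* Modulo `3` the map `f` is a translate of the Frobenius, so `G_k ≡ (u² + 1)^{3^k}`, and `H` is a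
  product of powers of `u - i` and `u + i` over `ℤ[i] / 3`, a field with nine elements.
* On the line `u = i` the critical orbit is `a, b, -2a, b, -2a, …`, so that `H` can be computed
  there: it is `3` times a linear polynomial in `a` whose leading coefficient is prime to `3`.

By the first fact, every nontrivial factor of `H` over `ℤ[i]` vanishes modulo `3` on one of the
lines `u = ±i`; by the second, which excludes divisibility by `9`, on each line this happens for
only one factor of a factorisation. This is Eisenstein's argument. It shows that `H` is irreducible
over `ℤ`, hence, by comparison of degrees, prime to the polynomials `f_{l,m}` of lower type, hence
equal to `h_{k,2}`; and it shows that over `ℤ[i]` there are at most two factors.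

To pass from `ℤ[i]` to `ℂ`, observe that the second fact also says that the line `u = i` meets
`H = 0` in a single point, transversally and with coordinates in `ℚ(i)`. The irreducible component
through this point is fixed by the Galois group of `ℚ(i)`, because a conjugate component would make
the intersection multiplicity at least two; having integral coefficients, its equation `A` is
defined over `ℤ[i]` (`exists_absolutely_irreducible_factor`). If `A ≠ H`, the reductions modulo `3`
identify the complementary factor both with the conjugate of `A` and with `± A(-a, -b)`
(`IsCore.irreducible_or_exists_isConjFactor`).

In either case the image of `H = 0` in `M₃` is the image of one irreducible plane curve `t = 0`.
This image is closed, infinite, and contained in every closed set that meets it in infinitely many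
points, since a polynomial vanishing at infinitely many points of `t = 0` is divisible by `t`. So it
is irreducible of dimension one. All but finitely many of its points are strictly preperiodic, as
`H` has no common factor with the `f_{l,m}` of lower type; hence it is the closure `Σ_{k,2}`.
-/

noncomputable section

namespace CubicModuli

/-! ### The factorisation of `f_{k,2}` over `ℤ` -/

theorem critIter_succ (m : ℕ) : critIter (m + 1) =
    critIter m ^ 3 - 3 * C X ^ 2 * critIter m + 2 * C X ^ 3 + Y := rfl

theorem critIter_zero : critIter 0 = C X := rfl

theorem critIter_one : critIter 1 = Y := by
  rw [critIter_succ, critIter_zero]; ring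

/-- The quotient `f_{k,2} / f_{k,1}`. -/
def perTwoQuot (k : ℕ) : ℤ[X][Y] :=
  1 + (critIter (k + 1) ^ 2 + critIter (k + 1) * critIter k + critIter k ^ 2 - 3 * C X ^ 2)

/-- The quotient of `f_{k+1,2} / f_{k+1,1}` by `f_{k,2} / f_{k,1}`. -/
def perTwoStep (k : ℕ) : ℤ[X][Y] :=
  1 + (critIter (k + 1) - critIter k) * (critIter k + critIter (k + 1) + critIter (k + 2))

theorem critIter_succ_sub (m n : ℕ) : critIter (m + 1) - critIter (n + 1) =
    (critIter m - critIter n) *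
      (critIter m ^ 2 + critIter m * critIter n + critIter n ^ 2 - 3 * C X ^ 2) := by
  rw [critIter_succ, critIter_succ]; ring

theorem fPoly_two (k : ℕ) : fPoly k 2 = fPoly k 1 * perTwoQuot k := by
  have h := critIter_succ_sub (k + 1) k
  unfold fPoly perTwoQuot
  linear_combination h

theorem perTwoQuot_succ (k : ℕ) : perTwoQuot (k + 1) = perTwoQuot k * perTwoStep k := by
  have h := critIter_succ_sub (k + 1) k
  unfold perTwoQuot perTwoStep
  linear_combination (critIter k + critIter (k + 1) + critIter (k + 2)) * h

theorem perTwoQuot_dvd_fPoly (k : ℕ) : perTwoQuot k ∣ fPoly k 2 :=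
  ⟨_, (fPoly_two k).trans (mul_comm _ _)⟩

theorem perTwoQuot_zero : perTwoQuot 0 = 1 + (Y - C X) * (Y + 2 * C X) := by
  unfold perTwoQuot
  rw [critIter_one, critIter_zero]; ring

theorem perTwoStep_zero : perTwoStep 0 = perTwoQuot 0 * ((Y - C X) ^ 2 + 1) := by
  rw [perTwoQuot_zero]; unfold perTwoStep
  rw [critIter_succ (0 + 1), critIter_one, critIter_zero]; ring

/-- On the curve `f_{0,2} / f_{0,1} = 0` the critical orbit alternates `a, b, a, b, …`. -/
theorem perTwoQuot_zero_dvd_critIter (j : ℕ) :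
    perTwoQuot 0 ∣ critIter (2 * j) - critIter 0 ∧
      perTwoQuot 0 ∣ critIter (2 * j + 1) - critIter 1 := by
  induction j with
  | zero => simp
  | succ j ih =>
    have h2 : perTwoQuot 0 ∣ critIter (2 * (j + 1)) - critIter 0 := by
      have e1 : perTwoQuot 0 ∣ critIter (2 * j + 1 + 1) - critIter (1 + 1) := by
        rw [critIter_succ_sub]; exact ih.2.mul_right _
      have e2 : perTwoQuot 0 ∣ critIter (1 + 1) - critIter 0 := perTwoQuot_dvd_fPoly 0
      simpa [mul_add] using dvd_add e1 e2
    refine ⟨h2, ?_⟩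
    have := critIter_succ_sub (2 * (j + 1)) 0
    rw [zero_add] at this
    rw [this]; exact h2.mul_right _

theorem perTwoQuot_zero_dvd_perTwoStep (j : ℕ) : perTwoQuot 0 ∣ perTwoStep (2 * j) := by
  obtain ⟨x, hx⟩ := (perTwoQuot_zero_dvd_critIter j).1
  obtain ⟨y, hy⟩ := (perTwoQuot_zero_dvd_critIter j).2
  obtain ⟨z, hz⟩ := (perTwoQuot_zero_dvd_critIter (j + 1)).1
  rw [critIter_zero] at hx hz
  rw [critIter_one] at hy
  have hz' : critIter (2 * j + 2) = C X + perTwoQuot 0 * z := by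
    rw [← hz]; simp [mul_add]
  unfold perTwoStep
  rw [eq_add_of_sub_eq hx, eq_add_of_sub_eq hy, hz']
  set g := perTwoQuot 0 with hg
  rw [perTwoQuot_zero] at hg
  -- Modulo `g` the step is `1 + (b - a)(2a + b) = g`.
  refine ⟨1 + (y - x) * (g * (x + y + z) + 2 * C X + Y) + (Y - C X) * (x + y + z), ?_⟩
  linear_combination -hg

theorem critIter_monic_natDegree (m : ℕ) :
    (critIter (m + 1)).Monic ∧ (critIter (m + 1)).natDegree = 3 ^ m := by
  induction m with
  | zero => rw [critIter_one]; exact ⟨monic_X, natDegree_X⟩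
  | succ m ih =>
    obtain ⟨hm, hd⟩ := ih
    have h3 : (critIter (m + 1) ^ 3).Monic := hm.pow 3
    have hd3 : (critIter (m + 1) ^ 3).natDegree = 3 ^ (m + 1) := by
      rw [hm.natDegree_pow, hd, pow_succ, mul_comm]
    set p : ℤ[X][Y] := C (-3 * X ^ 2) * critIter (m + 1) + (X + C (2 * X ^ 3)) with hp
    have hlt : p.degree < (critIter (m + 1) ^ 3).degree := by
      rw [degree_eq_natDegree h3.ne_zero, hd3]
      have h1 : (C (-3 * X ^ 2) * critIter (m + 1) : ℤ[X][Y]).natDegree ≤ 3 ^ m :=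
        (natDegree_C_mul_le _ _).trans hd.le
      have h2 : (X + C (2 * X ^ 3) : ℤ[X][Y]).natDegree = 1 := natDegree_X_add_C _
      refine degree_le_natDegree.trans_lt ?_
      have h3 : 1 ≤ 3 ^ m := Nat.one_le_pow _ _ (by norm_num)
      have h4 : p.natDegree ≤ 3 ^ m :=
        natDegree_add_le_of_degree_le h1 (h2.le.trans h3)
      exact_mod_cast h4.trans_lt (Nat.pow_lt_pow_right (by norm_num) (Nat.lt_succ_self m))
    have he : critIter (m + 1 + 1) = critIter (m + 1) ^ 3 + p := by
      rw [critIter_succ (m + 1), hp]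
      simp only [map_mul, map_neg, map_pow, map_ofNat]
      ring
    rw [he]
    exact ⟨h3.add_of_left hlt, by rw [natDegree_add_eq_left_of_degree_lt hlt, hd3]⟩

theorem fPoly_monic_natDegree (k n : ℕ) :
    (fPoly k (n + 1)).Monic ∧ (fPoly k (n + 1)).natDegree = 3 ^ (k + n) := by
  obtain ⟨hm, hd⟩ := critIter_monic_natDegree (k + n)
  have hlt : (-critIter k).degree < (critIter (k + n + 1)).degree := by
    rw [degree_eq_natDegree hm.ne_zero, hd, degree_neg]
    cases k with
    | zero =>
      rw [critIter_zero]
      refine degree_C_le.trans_lt ?_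
      exact_mod_cast (pow_pos (by norm_num : 0 < 3) (0 + n))
    | succ k =>
      obtain ⟨hm', hd'⟩ := critIter_monic_natDegree k
      rw [degree_eq_natDegree hm'.ne_zero, hd']
      exact_mod_cast Nat.pow_lt_pow_right (by norm_num : 1 < 3) (by omega)
  rw [fPoly, sub_eq_add_neg]
  exact ⟨hm.add_of_left hlt, by
    rw [← add_assoc k, natDegree_add_eq_left_of_degree_lt hlt, hd]⟩

theorem perTwoQuot_monic_natDegree (k : ℕ) :
    (perTwoQuot k).Monic ∧ (perTwoQuot k).natDegree = 2 * 3 ^ k := by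
  obtain ⟨h1, d1⟩ := fPoly_monic_natDegree k 0
  obtain ⟨h2, d2⟩ := fPoly_monic_natDegree k 1
  rw [fPoly_two] at h2 d2
  have hm := h1.of_mul_monic_left h2
  refine ⟨hm, ?_⟩
  rw [zero_add] at h1 d1
  rw [h1.natDegree_mul hm, d1, pow_succ] at d2
  simp only [add_zero] at d2
  omega

theorem perTwoStep_monic_natDegree (k : ℕ) :
    (perTwoStep k).Monic ∧ (perTwoStep k).natDegree = 4 * 3 ^ k := by
  obtain ⟨h1, d1⟩ := perTwoQuot_monic_natDegree k
  obtain ⟨h2, d2⟩ := perTwoQuot_monic_natDegree (k + 1)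
  rw [perTwoQuot_succ] at h2 d2
  have hm := h1.of_mul_monic_left h2
  refine ⟨hm, ?_⟩
  rw [h1.natDegree_mul hm, d1, pow_succ] at d2
  omega

/-! ### Base change, reflection and restriction to a line -/

section Hom

variable {S T U : Type*} [CommRing S] [CommRing T] [CommRing U]

/-- The map `S[a, b] → T[a, b]` applying `φ : S → T` to the coefficients. -/
def biMap (φ : S →+* T) : S[X][Y] →+* T[X][Y] := mapRingHom (mapRingHom φ)

/-- The substitution `(a, b) ↦ (-a, -b)` on `S[a, b]`. -/
def reflect (S : Type*) [CommRing S] : S[X][Y] →+* S[X][Y] :=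
  (compRingHom (-(Y : S[X][Y]))).comp (mapRingHom (compRingHom (-X)))

/-- Restriction of a polynomial in `a, b` to the line `b = a + ε`, as a polynomial in `a`. -/
def lineEval (ε : S) : S[X][Y] →+* S[X] := evalRingHom (X + C ε)

@[simp] theorem biMap_C_X (φ : S →+* T) : biMap φ (C X) = C X := by simp [biMap]

@[simp] theorem biMap_Y (φ : S →+* T) : biMap φ Y = Y := by simp [biMap]

@[simp] theorem biMap_C_C (φ : S →+* T) (s : S) : biMap φ (C (C s)) = C (C (φ s)) := by
  simp [biMap]

@[simp] theorem biMap_biMap (φ : S →+* T) (ψ : T →+* U) (p : S[X][Y]) :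
    biMap ψ (biMap φ p) = biMap (ψ.comp φ) p := by
  simp [biMap, Polynomial.map_map, ← mapRingHom_comp]

theorem coeff_coeff_biMap (φ : S →+* T) (p : S[X][Y]) (i j : ℕ) :
    ((biMap φ p).coeff j).coeff i = φ ((p.coeff j).coeff i) := by
  simp [biMap]

theorem biMap_id : biMap (RingHom.id S) = RingHom.id _ := by
  simp [biMap]

theorem biMap_injective {φ : S →+* T} (hφ : Function.Injective φ) :
    Function.Injective (biMap φ) :=
  map_injective _ (map_injective _ hφ)

theorem monic_biMap (φ : S →+* T) {p : S[X][Y]} (hp : p.Monic) : (biMap φ p).Monic :=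
  hp.map _

theorem natDegree_biMap [Nontrivial T] (φ : S →+* T) {p : S[X][Y]} (hp : p.Monic) :
    (biMap φ p).natDegree = p.natDegree :=
  hp.natDegree_map _

theorem monic_of_monic_biMap {φ : S →+* T} (hφ : Function.Injective φ) {p : S[X][Y]}
    (hp : (biMap φ p).Monic) : p.Monic :=
  monic_of_injective (map_injective _ hφ) hp

theorem biMap_dvd_biMap {φ : S →+* T} (hφ : Function.Injective φ) {p q : S[X][Y]}
    (hp : p.Monic) : biMap φ p ∣ biMap φ q ↔ p ∣ q :=
  map_dvd_map _ (map_injective _ hφ) hp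

@[simp] theorem reflect_C_X : reflect S (C X) = -(C X : S[X][Y]) := by simp [reflect]

@[simp] theorem reflect_Y : reflect S Y = -(Y : S[X][Y]) := by simp [reflect]

@[simp] theorem reflect_C_C (s : S) : reflect S (C (C s)) = C (C s) := by simp [reflect]

theorem hom_ext_bivariate {R : Type*} [CommRing R] {f g : S[X][Y] →+* R}
    (h : ∀ s, f (C (C s)) = g (C (C s))) (hX : f (C X) = g (C X)) (hY : f Y = g Y) : f = g := by
  refine Polynomial.ringHom_ext' (Polynomial.ringHom_ext' (RingHom.ext fun s => ?_) ?_) ?_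
  · simpa using h s
  · simpa using hX
  · simpa using hY

theorem reflect_biMap (φ : S →+* T) (p : S[X][Y]) :
    reflect T (biMap φ p) = biMap φ (reflect S p) := by
  have : (reflect T).comp (biMap φ) = (biMap φ).comp (reflect S) :=
    hom_ext_bivariate (by simp) (by simp) (by simp)
  exact RingHom.congr_fun this p

@[simp] theorem reflect_reflect (p : S[X][Y]) : reflect S (reflect S p) = p := by
  have : (reflect S).comp (reflect S) = RingHom.id _ :=
    hom_ext_bivariate (by simp) (by simp) (by simp)
  exact RingHom.congr_fun this p

@[simp] theorem lineEval_C_X (ε : S) : lineEval ε (C X) = X := by simp [lineEval]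

@[simp] theorem lineEval_Y (ε : S) : lineEval ε Y = X + C ε := by simp [lineEval]

@[simp] theorem lineEval_C_C (ε s : S) : lineEval ε (C (C s)) = C s := by simp [lineEval]

theorem lineEval_biMap (φ : S →+* T) (ε : S) (p : S[X][Y]) :
    lineEval (φ ε) (biMap φ p) = (lineEval ε p).map φ := by
  have : (lineEval (φ ε)).comp (biMap φ) = (mapRingHom φ).comp (lineEval ε) :=
    hom_ext_bivariate (by simp) (by simp) (by simp)
  exact RingHom.congr_fun this p

end Hom

/-! ### The critical orbit under reflection, on the line `b = a + i`, and modulo `3` -/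

theorem reflect_critIter (m : ℕ) : reflect ℤ (critIter m) = -critIter m := by
  induction m with
  | zero => simp [critIter_zero]
  | succ m ih =>
    rw [critIter_succ]
    simp only [map_add, map_sub, map_mul, map_pow, map_ofNat, ih, reflect_C_X, reflect_Y]
    ring

theorem reflect_perTwoQuot (k : ℕ) : reflect ℤ (perTwoQuot k) = perTwoQuot k := by
  simp only [perTwoQuot, map_add, map_sub, map_mul, map_pow, map_ofNat, reflect_critIter,
    reflect_C_X, map_one]
  ring

theorem reflect_perTwoStep (k : ℕ) : reflect ℤ (perTwoStep k) = perTwoStep k := by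
  simp only [perTwoStep, map_add, map_sub, map_mul, reflect_critIter, map_one]
  ring

/-- If `ε² = -1` and `b = a + ε`, then `f²(a) = -2a` is the other preimage of `f(a) = b`, so that
the critical orbit is `a, b, -2a, b, -2a, …`. -/
theorem lineEval_critIter {S : Type*} [CommRing S] {ε : S} (hε : ε ^ 2 = -1) (j : ℕ) :
    lineEval ε (biMap (Int.castRingHom S) (critIter (2 * j + 1))) = X + C ε ∧
      lineEval ε (biMap (Int.castRingHom S) (critIter (2 * j + 2))) = -2 * X := by
  have hC : (C ε : S[X]) ^ 2 = -1 := by rw [← C_pow, hε]; simp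
  have step : ∀ m, lineEval ε (biMap (Int.castRingHom S) (critIter m)) = X + C ε →
      lineEval ε (biMap (Int.castRingHom S) (critIter (m + 1))) = -2 * X := by
    intro m hm
    rw [critIter_succ]
    simp only [map_add, map_sub, map_mul, map_pow, map_ofNat, hm, biMap_C_X, biMap_Y, lineEval_C_X,
      lineEval_Y]
    linear_combination (3 * X + C ε) * hC
  have h1 : lineEval ε (biMap (Int.castRingHom S) (critIter (2 * j + 1))) = X + C ε := by
    induction j with
    | zero => simp [critIter_one]
    | succ j ih =>
      have h2 := step _ ih
      rw [mul_add, critIter_succ (2 * j + 2 * 1)]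
      simp only [map_add, map_sub, map_mul, map_pow, map_ofNat, h2, biMap_C_X, biMap_Y,
        lineEval_C_X, lineEval_Y, mul_one]
      ring
  exact ⟨h1, step _ h1⟩

section Line

variable {S : Type*} [CommRing S] {ε : S}

theorem lineEval_perTwoQuot_zero (hε : ε ^ 2 = -1) :
    lineEval ε (biMap (Int.castRingHom S) (perTwoQuot 0)) = 3 * (C ε * X) := by
  have hC : (C ε : S[X]) ^ 2 = -1 := by rw [← C_pow, hε]; simp
  rw [perTwoQuot_zero]
  simp only [map_add, map_sub, map_mul, map_ofNat, map_one, biMap_C_X, biMap_Y, lineEval_C_X,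
    lineEval_Y]
  linear_combination hC

theorem lineEval_perTwoStep_odd (hε : ε ^ 2 = -1) (j : ℕ) :
    lineEval ε (biMap (Int.castRingHom S) (perTwoStep (2 * j + 1))) = 3 * (1 - 2 * C ε * X) := by
  have hC : (C ε : S[X]) ^ 2 = -1 := by rw [← C_pow, hε]; simp
  have h1 := (lineEval_critIter hε j).1
  have h2 := (lineEval_critIter hε j).2
  have h3 : lineEval ε (biMap (Int.castRingHom S) (critIter (2 * j + 3))) = X + C ε :=
    (lineEval_critIter hε (j + 1)).1
  simp only [perTwoStep, map_add, map_sub, map_mul, map_one, h1, h2, h3]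
  linear_combination -2 * hC

theorem lineEval_perTwoStep_even (hε : ε ^ 2 = -1) (j : ℕ) :
    lineEval ε (biMap (Int.castRingHom S) (perTwoStep (2 * j + 2))) = -9 * X ^ 2 := by
  have hC : (C ε : S[X]) ^ 2 = -1 := by rw [← C_pow, hε]; simp
  have h1 := (lineEval_critIter hε j).2
  have h2 : lineEval ε (biMap (Int.castRingHom S) (critIter (2 * j + 3))) = X + C ε :=
    (lineEval_critIter hε (j + 1)).1
  have h3 : lineEval ε (biMap (Int.castRingHom S) (critIter (2 * j + 4))) = -2 * X :=
    (lineEval_critIter hε (j + 1)).2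
  simp only [perTwoStep, map_add, map_sub, map_mul, map_one, h1, h2, h3]
  linear_combination hC

end Line

section ModThree

variable {F : Type*} [CommRing F]

theorem three_eq_zero_bivariate (h3 : (3 : F) = 0) : (3 : F[X][Y]) = 0 := by
  have : (C (C (3 : F)) : F[X][Y]) = 0 := by rw [h3]; simp
  simpa only [map_ofNat] using this

/-- In characteristic `3` the map `f` is a translate of the Frobenius. -/
theorem biMap_fPoly_of_three_eq_zero (h3 : (3 : F) = 0) (k n : ℕ) :
    biMap (Int.castRingHom F) (fPoly k n) =
      biMap (Int.castRingHom F) (fPoly 0 n) ^ 3 ^ k := by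
  induction k with
  | zero => simp
  | succ k ih =>
    rw [pow_succ 3 k, pow_mul, ← ih, fPoly, show k + 1 + n = (k + n) + 1 by ring,
      critIter_succ_sub, fPoly]
    simp only [map_add, map_sub, map_mul, map_pow, map_ofNat, biMap_C_X]
    generalize biMap (Int.castRingHom F) (critIter (k + n)) = x
    generalize biMap (Int.castRingHom F) (critIter k) = y
    linear_combination (x - y) * (x * y - C X ^ 2) * three_eq_zero_bivariate h3

theorem biMap_perTwoQuot_of_three_eq_zero [IsDomain F] (h3 : (3 : F) = 0) (k : ℕ) :
    biMap (Int.castRingHom F) (perTwoQuot k) = ((Y - C X) ^ 2 + 1) ^ 3 ^ k := by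
  have hu : ∀ l, biMap (Int.castRingHom F) (fPoly l 1) = (Y - C X) ^ 3 ^ l := by
    intro l
    rw [biMap_fPoly_of_three_eq_zero h3, fPoly, zero_add, critIter_one, critIter_zero]
    simp
  have h0 : biMap (Int.castRingHom F) (perTwoQuot 0) = (Y - C X) ^ 2 + 1 := by
    rw [perTwoQuot_zero]
    simp only [map_add, map_sub, map_mul, map_ofNat, map_one, biMap_C_X, biMap_Y]
    linear_combination (Y - C X) * C X * three_eq_zero_bivariate h3
  have h := biMap_fPoly_of_three_eq_zero h3 k 2
  rw [fPoly_two, fPoly_two, map_mul, map_mul, hu, hu, h0, mul_pow, pow_zero, pow_one] at h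
  exact mul_left_cancel₀ (pow_ne_zero _ (X_sub_C_ne_zero _)) h

end ModThree

/-! ### The core factor of `f_{k,2}` -/

/-- The properties of `h_{k,2}`, for `k ≠ 1`, from which its factorisation is determined: its
complement in `f_{k,2} / f_{k,1}` consists of factors of polynomials `f_{l,m}` of lower type, its
degree exceeds theirs, and on each of the lines `b = a ± i` it is `3` times a linear polynomial
whose leading coefficient is prime to `3`. -/
structure IsCore (k : ℕ) (H : ℤ[X][Y]) : Prop where
  monic : H.Monic
  lt_natDegree : 3 ^ k < H.natDegree
  reflect_eq : reflect ℤ H = H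
  exists_mul_eq : ∃ L, perTwoQuot k = L * H ∧
    ∀ g, Prime g → g ∣ L → ∃ l, l < k ∧ g ∣ fPoly l 2
  line : ∃ q r : ℤ, ¬ 3 ∣ q ∧ ∀ (S : Type) [CommRing S] [IsDomain S] [CharZero S] (ε : S),
    ε ^ 2 = -1 → lineEval ε (biMap (Int.castRingHom S) H) = 3 * (C (q * ε) * X + C (r : S))

theorem exists_isCore {k : ℕ} (hk : k ≠ 1) : ∃ H, IsCore k H := by
  obtain rfl | ⟨j, rfl⟩ | ⟨j, rfl⟩ :
      k = 0 ∨ (∃ j, k = 2 * j + 1 + 1) ∨ ∃ j, k = 2 * j + 2 + 1 := by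
    rcases Nat.even_or_odd' k with ⟨j, rfl | rfl⟩
    · cases j with
      | zero => simp
      | succ j => exact Or.inr (Or.inl ⟨j, by ring⟩)
    · cases j with
      | zero => simp at hk
      | succ j => exact Or.inr (Or.inr ⟨j, by ring⟩)
  · refine ⟨perTwoQuot 0, (perTwoQuot_monic_natDegree 0).1, ?_, reflect_perTwoQuot 0,
      ⟨1, (one_mul _).symm, fun g hg h1 => (hg.not_isUnit (isUnit_of_dvd_one h1)).elim⟩,
      ⟨1, 0, by norm_num, ?_⟩⟩
    · rw [(perTwoQuot_monic_natDegree 0).2]; norm_num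
    · intro S _ _ _ ε hε
      rw [lineEval_perTwoQuot_zero hε]; simp
  · have hd := (perTwoStep_monic_natDegree (2 * j + 1)).2
    refine ⟨perTwoStep (2 * j + 1), (perTwoStep_monic_natDegree _).1, ?_, reflect_perTwoStep _,
      ⟨perTwoQuot (2 * j + 1), perTwoQuot_succ _, fun g _ h1 => ⟨2 * j + 1, by omega,
        h1.trans (perTwoQuot_dvd_fPoly _)⟩⟩, ⟨-2, 1, by norm_num, ?_⟩⟩
    · rw [hd, pow_succ]
      have := pow_pos (by norm_num : 0 < 3) (2 * j + 1)
      omega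
    · intro S _ _ _ ε hε
      rw [lineEval_perTwoStep_odd hε]; simp [← map_ofNat C 2]; ring
  · obtain ⟨H, hH⟩ := perTwoQuot_zero_dvd_perTwoStep (j + 1)
    rw [mul_add, mul_one] at hH
    obtain ⟨hm0, hd0⟩ := perTwoQuot_monic_natDegree 0
    obtain ⟨hm1, hd1⟩ := perTwoStep_monic_natDegree (2 * j + 2)
    have hm : H.Monic := hm0.of_mul_monic_left (hH ▸ hm1)
    refine ⟨H, hm, ?_, ?_, ⟨perTwoQuot (2 * j + 2) * perTwoQuot 0, ?_, ?_⟩,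
      ⟨1, 0, by norm_num, ?_⟩⟩
    · rw [hH, hm0.natDegree_mul hm, hd0] at hd1
      have : 3 ^ 2 ≤ 3 ^ (2 * j + 2) := Nat.pow_le_pow_right (by norm_num) (by omega)
      rw [pow_succ]
      omega
    · have := reflect_perTwoStep (2 * j + 2)
      rw [hH, map_mul, reflect_perTwoQuot] at this
      exact mul_left_cancel₀ hm0.ne_zero this
    · rw [perTwoQuot_succ, hH, mul_assoc]
    · intro g hg h1
      rcases hg.dvd_or_dvd h1 with h1 | h1
      · exact ⟨_, by omega, h1.trans (perTwoQuot_dvd_fPoly _)⟩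
      · exact ⟨_, by omega, h1.trans (perTwoQuot_dvd_fPoly _)⟩
    · intro S _ _ _ ε hε
      have hC : (C ε : S[X]) ^ 2 = -1 := by rw [← C_pow, hε]; simp
      have h := lineEval_perTwoStep_even hε j
      rw [hH, map_mul, map_mul, lineEval_perTwoQuot_zero hε] at h
      have hε0 : ε ≠ 0 := by rintro rfl; simp at hε
      have h0 : (3 : S[X]) * (C ε * X) ≠ 0 :=
        mul_ne_zero (by norm_num) (mul_ne_zero (C_ne_zero.2 hε0) X_ne_zero)
      refine mul_left_cancel₀ h0 (h.trans ?_)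
      simp
      linear_combination -9 * X ^ 2 * hC

/-! ### Factorisations over `ℤ[i]` modulo `3` -/

/-- The imaginary unit of `ℤ[i]`. -/
def gI : GaussianInt := Zsqrtd.sqrtd

theorem gI_sq : gI ^ 2 = -1 := by
  rw [gI, pow_two, Zsqrtd.dmuld]; rfl

theorem neg_gI_sq : (-gI) ^ 2 = -1 := by rw [neg_sq, gI_sq]

/-- Complex conjugation on `ℤ[i]`. -/
def gConj : GaussianInt →+* GaussianInt := starRingEnd GaussianInt

theorem gConj_gI : gConj gI = -gI := by
  change star gI = -gI
  rw [gI]; ext <;> simp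

@[simp] theorem gConj_gConj (x : GaussianInt) : gConj (gConj x) = x := star_star x

theorem gConj_comp_gConj : gConj.comp gConj = RingHom.id _ := RingHom.ext gConj_gConj

/-- A polynomial of `ℤ[a, b]` viewed in `ℤ[i][a, b]`. -/
abbrev toG (H : ℤ[X][Y]) : GaussianInt[X][Y] := biMap (Int.castRingHom GaussianInt) H

theorem biMap_gConj_toG (H : ℤ[X][Y]) : biMap gConj (toG H) = toG H := by
  rw [biMap_biMap]; congr 1

theorem three_dvd_iff_coeff {S : Type*} [CommRing S] (p : S[X]) :
    (3 : S[X]) ∣ p ↔ ∀ n, (3 : S) ∣ p.coeff n := by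
  rw [← C_dvd_iff_dvd_coeff, map_ofNat]

theorem three_dvd_map {S T : Type*} [CommRing S] [CommRing T] (φ : S →+* T) {p : S[X]}
    (h : (3 : S[X]) ∣ p) : (3 : T[X]) ∣ p.map φ := by
  simpa using map_dvd (mapRingHom φ) h

theorem three_dvd_lineEval_gConj (A : GaussianInt[X][Y]) {ε : GaussianInt} :
    3 ∣ lineEval (gConj ε) (biMap gConj A) ↔ 3 ∣ lineEval ε A := by
  rw [lineEval_biMap]
  refine ⟨fun h => ?_, three_dvd_map _⟩
  simpa [Polynomial.map_map, gConj_comp_gConj] using three_dvd_map gConj h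

theorem lineEval_reflect {S : Type*} [CommRing S] (ε : S) (p : S[X][Y]) :
    lineEval ε (reflect S p) = (lineEval (-ε) p).comp (-X) := by
  have : (lineEval ε).comp (reflect S) = (compRingHom (-X)).comp (lineEval (-ε)) :=
    hom_ext_bivariate (by simp) (by simp) (by simp; ring)
  exact RingHom.congr_fun this p

theorem three_dvd_lineEval_reflect {S : Type*} [CommRing S] (A : S[X][Y]) {ε : S} :
    3 ∣ lineEval ε (reflect S A) ↔ 3 ∣ lineEval (-ε) A := by
  have key : ∀ (ε : S) (A : S[X][Y]), 3 ∣ lineEval (-ε) A → 3 ∣ lineEval ε (reflect S A) := by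
    intro ε A h
    rw [lineEval_reflect]
    simpa using map_dvd (compRingHom (-X)) h
  refine ⟨fun h => ?_, key ε A⟩
  rw [← neg_neg ε] at h
  simpa using key (-ε) (reflect S A) h

namespace IsCore

variable {k : ℕ} {H : ℤ[X][Y]}

theorem dvd_perTwoQuot (hH : IsCore k H) : H ∣ perTwoQuot k := by
  obtain ⟨L, hL, -⟩ := hH.exists_mul_eq
  exact ⟨L, hL.trans (mul_comm _ _)⟩

/-- Eisenstein's argument: two factors cannot both vanish modulo `3` on the line `b = a + ε`, as
`H` does not vanish there modulo `9`. -/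
theorem not_three_dvd (hH : IsCore k H) {A B : GaussianInt[X][Y]} (hAB : A * B = toG H)
    {ε : GaussianInt} (hε : ε ^ 2 = -1) (hA : 3 ∣ lineEval ε A) : ¬ 3 ∣ lineEval ε B := by
  intro hB
  obtain ⟨q, r, hq, hl⟩ := hH.line
  have h := mul_dvd_mul hA hB
  rw [← map_mul, hAB, hl GaussianInt ε hε] at h
  have h3 : (3 : GaussianInt[X]) ≠ 0 := by norm_num
  have h1 := (three_dvd_iff_coeff _).1 ((mul_dvd_mul_iff_left h3).1 h) 1
  simp only [coeff_add, coeff_C_mul, coeff_X_one, mul_one, coeff_C_succ, add_zero] at h1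
  have h2 : ((3 : ℤ) : GaussianInt) ∣ ((-q : ℤ) : GaussianInt) := by
    have := h1.mul_right ε
    rw [mul_assoc, ← pow_two, hε] at this
    simpa using this
  rw [Zsqrtd.intCast_dvd_intCast] at h2
  exact hq ((dvd_neg).1 h2)

theorem eq_one_of_dvd_of_field (hH : IsCore k H) {F : Type*} [Field F] (π : GaussianInt →+* F)
    (hπ : ∀ x, π x = 0 ↔ 3 ∣ x) {A : GaussianInt[X][Y]} (hA : A.Monic)
    (hd : A ∣ toG H) (h1 : ¬ 3 ∣ lineEval gI A) (h2 : ¬ 3 ∣ lineEval (-gI) A) : A = 1 := by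
  have h3 : (3 : F) = 0 := by
    have := (hπ 3).2 dvd_rfl
    rwa [map_ofNat] at this
  have hline : ∀ ε : GaussianInt, (Y - C (X + C (π ε))) ∣ biMap π A → 3 ∣ lineEval ε A := by
    intro ε h
    rw [dvd_iff_isRoot] at h
    have h' : lineEval (π ε) (biMap π A) = 0 := h
    rw [lineEval_biMap] at h'
    rw [three_dvd_iff_coeff]
    intro n
    rw [← hπ, ← coeff_map, h', coeff_zero]
  have hprod : ((Y - C X) ^ 2 + 1 : F[X][Y]) =
      (Y - C (X + C (π gI))) * (Y - C (X + C (π (-gI)))) := by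
    have hI : (C (C (π gI)) : F[X][Y]) ^ 2 = -1 := by
      rw [← C_pow, ← C_pow, ← map_pow, gI_sq]; simp
    simp only [C_add, map_neg]
    linear_combination hI
  have hdvd : biMap π A ∣ ((Y - C (X + C (π gI))) * (Y - C (X + C (π (-gI))))) ^ 3 ^ k := by
    rw [← hprod, ← biMap_perTwoQuot_of_three_eq_zero h3]
    refine (_root_.map_dvd (biMap π) hd).trans ?_
    rw [biMap_biMap, show π.comp (Int.castRingHom GaussianInt) = Int.castRingHom F from
      RingHom.ext_int _ _]
    exact _root_.map_dvd _ hH.dvd_perTwoQuot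
  have hrel : ∀ ε : GaussianInt, ¬ 3 ∣ lineEval ε A →
      IsRelPrime (biMap π A) (Y - C (X + C (π ε))) := fun ε h =>
    ((irreducible_X_sub_C _).isRelPrime_iff_not_dvd.2 fun h' => h (hline ε h')).symm
  have hunit : IsUnit (biMap π A) :=
    ((hrel _ h1).mul_right (hrel _ h2)).pow_right.isUnit_of_dvd hdvd
  have hdeg := natDegree_biMap π hA
  rw [(monic_biMap π hA).isUnit_iff.1 hunit, natDegree_one] at hdeg
  exact hA.natDegree_eq_zero.1 hdeg.symm

/-- Modulo `3` the polynomial `H` divides a power of `(b - a - i)(b - a + i)`, so a factor that does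
not vanish modulo `3` on either of the lines `b = a ± i` is trivial. -/
theorem eq_one_of_dvd (hH : IsCore k H) {A : GaussianInt[X][Y]} (hA : A.Monic)
    (hd : A ∣ toG H) (h1 : ¬ 3 ∣ lineEval gI A) (h2 : ¬ 3 ∣ lineEval (-gI) A) : A = 1 := by
  have h3p : Prime (3 : GaussianInt) := by
    have : Fact (Nat.Prime 3) := ⟨Nat.prime_three⟩
    exact_mod_cast GaussianInt.prime_of_nat_prime_of_mod_four_eq_three 3 (by norm_num)
  have hmax : (Ideal.span {(3 : GaussianInt)}).IsMaximal :=
    PrincipalIdealRing.isMaximal_of_irreducible h3p.irreducible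
  refine @eq_one_of_dvd_of_field k H hH (GaussianInt ⧸ Ideal.span {(3 : GaussianInt)})
    (Ideal.Quotient.field _) (Ideal.Quotient.mk _) (fun x => ?_) A hA hd h1 h2
  rw [← Ideal.mem_span_singleton]
  exact Ideal.Quotient.eq_zero_iff_mem

theorem natDegree_pos (hH : IsCore k H) : 0 < H.natDegree :=
  (Nat.zero_le _).trans_lt hH.lt_natDegree

/-- Over `ℤ` each nontrivial factor of `H` is its own conjugate, so modulo `3` it vanishes on both
of the lines `b = a ± i`; hence there is only one. -/
theorem irreducible (hH : IsCore k H) : Irreducible H := by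
  have hH1 : H ≠ 1 := by
    rintro rfl
    simpa using hH.natDegree_pos
  rw [irreducible_of_monic hH.monic hH1]
  intro A B hA hB hAB
  have hABG : toG A * toG B = toG H := by rw [← hAB, ← map_mul]
  have hswap : ∀ D : ℤ[X][Y], 3 ∣ lineEval (-gI) (toG D) ↔ 3 ∣ lineEval gI (toG D) := by
    intro D
    have := three_dvd_lineEval_gConj (toG D) (ε := gI)
    rwa [biMap_gConj_toG, gConj_gI] at this
  have hone : ∀ D : ℤ[X][Y], D.Monic → toG D ∣ toG H → ¬ 3 ∣ lineEval gI (toG D) → D = 1 := by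
    intro D hD hd h
    have := hH.eq_one_of_dvd (monic_biMap _ hD) hd h (mt (hswap D).1 h)
    exact biMap_injective (RingHom.injective_int _) (this.trans (map_one _).symm)
  by_cases h : 3 ∣ lineEval gI (toG A)
  · exact Or.inr (hone B hB ⟨_, hABG.symm.trans (mul_comm _ _)⟩ (hH.not_three_dvd hABG gI_sq h))
  · exact Or.inl (hone A hA ⟨_, hABG.symm⟩ h)

end IsCore

/-! ### Identification of `h_{k,2}` -/

theorem exists_monic_associated {R : Type*} [CommRing R] [IsDomain R] {g p : R[X]}
    (hp : p.Monic) (hg : g ∣ p) : ∃ g', g'.Monic ∧ Associated g g' := by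
  obtain ⟨q, rfl⟩ := hg
  have h : g.leadingCoeff * q.leadingCoeff = 1 := by rw [← leadingCoeff_mul]; exact hp
  refine ⟨g * C q.leadingCoeff, ?_, ?_⟩
  · rw [Monic, leadingCoeff_mul, leadingCoeff_C, h]
  · exact associated_mul_unit_right _ _ (isUnit_C.2 (IsUnit.of_mul_eq_one_right _ h))

theorem finite_monic_irreducible_dvd {p : ℤ[X][Y]} (hp : p ≠ 0) :
    {g : ℤ[X][Y] | Irreducible g ∧ g.Monic ∧ g ∣ p}.Finite := by
  classical
  have hsub : {g : ℤ[X][Y] | Irreducible g ∧ g.Monic ∧ g ∣ p} ⊆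
      ⋃ q ∈ (UniqueFactorizationMonoid.factors p).toFinset, {g | g.Monic ∧ Associated g q} := by
    rintro g ⟨hg, hm, hd⟩
    obtain ⟨q, hq, ha⟩ := UniqueFactorizationMonoid.exists_mem_factors_of_dvd hp hg hd
    simp only [Set.mem_iUnion]
    exact ⟨q, Multiset.mem_toFinset.2 hq, hm, ha⟩
  refine (Set.Finite.biUnion (Finset.finite_toSet _) fun q _ => ?_).subset hsub
  refine Set.Subsingleton.finite fun g hg g' hg' => ?_
  exact eq_of_monic_of_associated hg.1 hg'.1 (hg.2.trans hg'.2.symm)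

/-- `(l, m)` is one of the indices whose `f_{l,m}` is removed from `f_{k,n}` in forming
`h_{k,n}`. -/
def IsLower (k n l m : ℕ) : Prop := l ≤ k ∧ 1 ≤ m ∧ m ∣ n ∧ (l, m) ≠ (k, n)

theorem mem_lowerFactors {k n : ℕ} {g : ℤ[X][Y]} : g ∈ lowerFactors k n ↔
    Irreducible g ∧ g.Monic ∧ ∃ l m, IsLower k n l m ∧ g ∣ fPoly l m := by
  simp only [lowerFactors, IsLower, Set.mem_ofPred_eq, and_assoc]

/-- The divisor `∏ gᵢ^{αᵢ}` divides `f_{k,n}` and removes from it all the factors `gᵢ`. -/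
theorem exists_lowerPart_mul {k n : ℕ} (hf : (fPoly k n).Monic) :
    (lowerPart k n).Monic ∧ fPoly k n = lowerPart k n * hPoly k n ∧
      (∀ g ∈ lowerFactors k n, ¬ g ∣ hPoly k n) ∧
      ∀ p, Prime p → p ∣ lowerPart k n → ∃ g ∈ lowerFactors k n, p ∣ g := by
  classical
  set f := fPoly k n with hfdef
  have hfin : (lowerFactors k n ∩ {g | g ∣ f}).Finite :=
    (finite_monic_irreducible_dvd hf.ne_zero).subset fun g hg =>
      ⟨hg.1.1, hg.1.2.1, hg.2⟩
  set T := hfin.toFinset with hT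
  have hTmem : ∀ g, g ∈ T ↔ g ∈ lowerFactors k n ∧ g ∣ f := fun g => by simp [hT]
  have hprod : lowerPart k n = ∏ g ∈ T, g ^ multiplicity g f := by
    refine finprod_mem_eq_prod_of_inter_mulSupport_eq _ ?_
    ext g
    simp only [Set.mem_inter_iff, Function.mem_mulSupport, SetLike.mem_coe, hTmem]
    refine ⟨fun h => ⟨⟨h.1, ?_⟩, h.2⟩, fun h => ⟨h.1.1, h.2⟩⟩
    by_contra hd
    exact h.2 (by rw [multiplicity_eq_zero.2 hd, pow_zero])
  have hm : (lowerPart k n).Monic := by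
    rw [hprod]
    exact monic_prod_of_monic _ _ fun g hg => ((hTmem g).1 hg).1.2.1.pow _
  have hdvd : lowerPart k n ∣ f := by
    rw [hprod]
    refine Finset.prod_dvd_of_isRelPrime ?_ fun g _ => pow_multiplicity_dvd _ _
    intro g hg g' hg' hne
    have h := ((hTmem g).1 hg).1
    have h' := ((hTmem g').1 hg').1
    refine IsRelPrime.pow (h.1.isRelPrime_iff_not_dvd.2 fun hd => hne ?_)
    exact eq_of_monic_of_associated h.2.1 h'.2.1 (h.1.associated_of_dvd h'.1 hd)
  obtain ⟨h, hh⟩ := hdvd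
  have hhP : hPoly k n = h := by
    rw [hPoly, ← hfdef, hh, mul_divByMonic_cancel_left _ hm]
  rw [hhP]
  refine ⟨hm, hh, fun g hg hd => ?_, fun p hp hd => ?_⟩
  · have hgT : g ∈ T := (hTmem g).2 ⟨hg, hd.trans ⟨_, hh.trans (mul_comm _ _)⟩⟩
    have hfm : FiniteMultiplicity g f :=
      FiniteMultiplicity.of_prime_left hg.1.prime hf.ne_zero
    refine hfm.not_pow_dvd_of_multiplicity_lt (Nat.lt_succ_self _) ?_
    rw [pow_succ, hh]
    refine mul_dvd_mul ?_ hd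
    rw [← hh, hprod]
    exact Finset.dvd_prod_of_mem (fun g => g ^ multiplicity g f) hgT
  · rw [hprod, hp.dvd_finsetProd_iff] at hd
    obtain ⟨g, hg, hpg⟩ := hd
    exact ⟨g, ((hTmem g).1 hg).1, hp.dvd_of_dvd_pow hpg⟩

theorem hPoly_eq {k n : ℕ} {H L : ℤ[X][Y]} (hf : fPoly k n = L * H) (hfm : (fPoly k n).Monic)
    (hm : H.Monic) (hirr : Irreducible H)
    (hL : ∀ g, Prime g → g ∣ L → ∃ l m, IsLower k n l m ∧ g ∣ fPoly l m)
    (hH : ∀ l m, IsLower k n l m → ¬ H ∣ fPoly l m) : hPoly k n = H := by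
  obtain ⟨hlm, hlf, hfac, hpr⟩ := exists_lowerPart_mul hfm
  have hhm : (hPoly k n).Monic := hlm.of_mul_monic_left (hlf ▸ hfm)
  have h1 : H ∣ hPoly k n := by
    have : H ∣ lowerPart k n * hPoly k n := hlf ▸ ⟨L, hf.trans (mul_comm _ _)⟩
    refine (hirr.prime.dvd_or_dvd this).resolve_left fun hd => ?_
    obtain ⟨g, hg, hHg⟩ := hpr H hirr.prime hd
    obtain ⟨-, -, l, m, hlow, hgf⟩ := mem_lowerFactors.1 hg
    exact hH l m hlow (hHg.trans hgf)
  have h2 : IsRelPrime (hPoly k n) L := by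
    refine WfDvdMonoid.isRelPrime_of_no_irreducible_factors (fun h => hhm.ne_zero h.1) ?_
    intro g hg hgh hgL
    obtain ⟨l, m, hlow, hgf⟩ := hL g hg.prime hgL
    obtain ⟨g', hg'm, hass⟩ := exists_monic_associated hhm hgh
    exact hfac g' (mem_lowerFactors.2 ⟨hass.irreducible hg, hg'm, l, m, hlow,
      hass.dvd_iff_dvd_left.1 hgf⟩) (hass.dvd_iff_dvd_left.1 hgh)
  have h3 : hPoly k n ∣ H := h2.dvd_of_dvd_mul_left (hf ▸ ⟨_, hlf.trans (mul_comm _ _)⟩)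
  exact eq_of_monic_of_associated hhm hm (associated_of_dvd_dvd h3 h1)

theorem isLower_two {k l m : ℕ} (h : IsLower k 2 l m) : (m = 1 ∧ l ≤ k) ∨ (m = 2 ∧ l < k) := by
  obtain ⟨h1, h2, h3, h4⟩ := h
  have : m ≤ 2 := Nat.le_of_dvd (by norm_num) h3
  interval_cases m
  · simp [h1]
  · right
    refine ⟨rfl, lt_of_le_of_ne h1 ?_⟩
    rintro rfl
    exact h4 rfl

namespace IsCore

variable {k : ℕ} {H : ℤ[X][Y]}

theorem not_dvd_fPoly (hH : IsCore k H) {l m : ℕ} (h : IsLower k 2 l m) : ¬ H ∣ fPoly l m := by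
  intro hd
  have hlt := hH.lt_natDegree
  rcases isLower_two h with ⟨rfl, hl⟩ | ⟨rfl, hl⟩
  · obtain ⟨hm, hdeg⟩ := fPoly_monic_natDegree l 0
    have := natDegree_le_of_dvd hd hm.ne_zero
    rw [hdeg] at this
    have := Nat.pow_le_pow_right (by norm_num : 0 < 3) hl
    simp only [add_zero] at *
    omega
  · obtain ⟨hm, hdeg⟩ := fPoly_monic_natDegree l 1
    have := natDegree_le_of_dvd hd hm.ne_zero
    rw [hdeg] at this
    have := Nat.pow_le_pow_right (by norm_num : 0 < 3) (Nat.succ_le_of_lt hl)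
    simp only [Nat.succ_eq_add_one] at *
    omega

theorem hPoly_two (hH : IsCore k H) : hPoly k 2 = H := by
  obtain ⟨L, hL, hfac⟩ := hH.exists_mul_eq
  refine hPoly_eq (L := fPoly k 1 * L) (by rw [fPoly_two, hL, mul_assoc])
    (fPoly_monic_natDegree k 1).1 hH.monic hH.irreducible ?_ fun l m => hH.not_dvd_fPoly
  intro g hg hd
  rcases hg.dvd_or_dvd hd with hd | hd
  · exact ⟨k, 1, ⟨le_rfl, le_rfl, one_dvd _, by simp⟩, hd⟩
  · obtain ⟨l, hl, hgl⟩ := hfac g hg hd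
    exact ⟨l, 2, ⟨hl.le, by norm_num, dvd_rfl, by simp [hl.ne]⟩, hgl⟩

end IsCore

/-! ### Descent of an absolutely irreducible factor -/

theorem exists_biMap_eq {S T : Type*} [CommRing S] [CommRing T] (φ : S →+* T) {p : T[X][Y]}
    (h : ∀ i j, (p.coeff j).coeff i ∈ φ.range) : ∃ q, biMap φ q = p := by
  have : p ∈ lifts (mapRingHom φ) := by
    rw [lifts_iff_coeff_lifts]
    intro j
    have hj : p.coeff j ∈ lifts φ := by
      rw [lifts_iff_coeff_lifts]
      exact fun i => h i j
    simpa [lifts] using hj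
  simpa [mem_lifts, biMap] using this

section Descent

attribute [local instance] Polynomial.algebra

theorem isIntegral_coeff_coeff {R L : Type*} [CommRing R] [Field L] [Algebra R L]
    {H : R[X][Y]} (hH : H.Monic) {A : L[X][Y]} (hA : A.Monic)
    (hd : A ∣ biMap (algebraMap R L) H) (i j : ℕ) : IsIntegral R ((A.coeff j).coeff i) :=
  (isIntegral_coeff_of_dvd (R := R[X]) (S := L[X]) H A hH hA hd j).coeff i

variable {R K L : Type*} [CommRing R] [IsIntegrallyClosed R] [Field K] [CharZero K]
  [Algebra R K] [IsFractionRing R K] [Field L] [IsAlgClosed L] [Algebra R L] [Algebra K L]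
  [IsScalarTower R K L]

/-- If the line `b = a + ε` meets the curve `H = 0` transversally in a point whose coordinates lie
in the field of fractions `K` of `R`, then the absolutely irreducible component through that point
is invariant under the Galois group of `K`, hence defined over `R`. -/
theorem exists_absolutely_irreducible_factor {H : R[X][Y]} (hH : H.Monic) {ε : R} {x : K}
    (hx : eval x ((lineEval ε H).map (algebraMap R K)) = 0)
    (hx2 : ¬ (X - C x) ^ 2 ∣ (lineEval ε H).map (algebraMap R K)) :
    ∃ A : R[X][Y], A.Monic ∧ Irreducible (biMap (algebraMap R L) A) ∧ A ∣ H := by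
  have hinjRK : Function.Injective (algebraMap R K) := IsFractionRing.injective R K
  have hRL : (algebraMap K L).comp (algebraMap R K) = algebraMap R L :=
    (IsScalarTower.algebraMap_eq R K L).symm
  have hinj : Function.Injective (algebraMap R L) := by
    rw [← hRL]; exact (algebraMap K L).injective.comp hinjRK
  -- The irreducible factor over `L` through the given point.
  obtain ⟨A, hAm, hAirr, hAd, hA0⟩ : ∃ A : L[X][Y], A.Monic ∧ Irreducible A ∧
      A ∣ biMap (algebraMap R L) H ∧
      eval (algebraMap K L x) (lineEval (algebraMap R L ε) A) = 0 := by
    have hHL := monic_biMap (algebraMap R L) hH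
    let ev : L[X][Y] →+* L := (evalRingHom (algebraMap K L x)).comp (lineEval (algebraMap R L ε))
    have hev : ev (biMap (algebraMap R L) H) = 0 := by
      change eval _ (lineEval _ _) = 0
      rw [lineEval_biMap, ← hRL, ← Polynomial.map_map, eval_map_apply, hx, map_zero]
    obtain ⟨s, hs, hass⟩ := WfDvdMonoid.exists_factors _ hHL.ne_zero
    have hs0 : ev s.prod = 0 := by
      obtain ⟨v, hv⟩ := hass.symm
      rw [← hv, map_mul, hev, zero_mul]
    rw [map_multiset_prod, Multiset.prod_eq_zero_iff, Multiset.mem_map] at hs0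
    obtain ⟨B, hB, hB0⟩ := hs0
    have hBd : B ∣ biMap (algebraMap R L) H := (Multiset.dvd_prod hB).trans hass.dvd
    obtain ⟨A, hA, hBA⟩ := exists_monic_associated hHL hBd
    refine ⟨A, hA, hBA.irreducible (hs B hB), hBA.dvd_iff_dvd_left.1 hBd, ?_⟩
    obtain ⟨v, hv⟩ := hBA
    change ev A = 0
    rw [← hv, map_mul, hB0, zero_mul]
  -- It is defined over the algebraic closure `E` of `K` in `L`.
  let E := algebraicClosure K L
  have hint := isIntegral_coeff_coeff hH hAm hAd
  obtain ⟨A', rfl⟩ : ∃ A' : E[X][Y], biMap (algebraMap E L) A' = A := by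
    refine exists_biMap_eq _ fun i j => ⟨⟨_, ?_⟩, rfl⟩
    exact (mem_algebraicClosure_iff).2 ((hint i j).tower_top (A := K)).isAlgebraic
  have hinjE : Function.Injective (algebraMap E L) := (algebraMap E L).injective
  have hKEL : (algebraMap E L).comp (algebraMap K E) = algebraMap K L :=
    (IsScalarTower.algebraMap_eq K E L).symm
  have hRKE : (algebraMap K E).comp (algebraMap R K) = algebraMap R E :=
    (IsScalarTower.algebraMap_eq R K E).symm
  have hREL : (algebraMap E L).comp (algebraMap R E) = algebraMap R L := by
    rw [← hRKE, ← RingHom.comp_assoc, hKEL, hRL]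
  have hA'm : A'.Monic := monic_of_monic_biMap hinjE hAm
  have hA'irr : Irreducible A' := hA'm.irreducible_of_irreducible_map _ _ hAirr
  have hA'd : A' ∣ biMap (algebraMap R E) H := by
    rw [← biMap_dvd_biMap hinjE hA'm, biMap_biMap, hREL]; exact hAd
  have hA'0 : eval (algebraMap K E x) (lineEval (algebraMap R E ε) A') = 0 := by
    apply hinjE
    have h1 : algebraMap E L (algebraMap R E ε) = algebraMap R L ε := RingHom.congr_fun hREL ε
    have h2 : algebraMap E L (algebraMap K E x) = algebraMap K L x := RingHom.congr_fun hKEL x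
    rw [← eval_map_apply, ← lineEval_biMap, map_zero, h1, h2]
    exact hA0
  -- A conjugate of `A'` different from it would be a second factor through the same point.
  have hfix : ∀ σ : E ≃ₐ[K] E, biMap (σ : E →+* E) A' = A' := by
    intro σ
    by_contra hne
    have hσR : (σ : E →+* E).comp (algebraMap R E) = algebraMap R E := by
      rw [← hRKE, ← RingHom.comp_assoc]
      congr 1
      exact RingHom.ext fun y => σ.commutes y
    have hσm : (biMap (σ : E →+* E) A').Monic := monic_biMap _ hA'm
    have hσirr : Irreducible (biMap (σ : E →+* E) A') := by
      refine hσm.irreducible_of_irreducible_map (mapRingHom (σ.symm : E →+* E)) _ ?_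
      have : biMap (σ.symm : E →+* E) (biMap (σ : E →+* E) A') = A' := by
        rw [biMap_biMap, show (σ.symm : E →+* E).comp (σ : E →+* E) = RingHom.id E from
          RingHom.ext fun y => σ.symm_apply_apply y, biMap_id, RingHom.id_apply]
      change Irreducible (biMap (σ.symm : E →+* E) (biMap (σ : E →+* E) A'))
      rwa [this]
    have hσd : biMap (σ : E →+* E) A' ∣ biMap (algebraMap R E) H := by
      have := _root_.map_dvd (biMap (σ : E →+* E)) hA'd
      rwa [biMap_biMap, hσR] at this
    have hσ0 : eval (algebraMap K E x)
        (lineEval (algebraMap R E ε) (biMap (σ : E →+* E) A')) = 0 := by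
      have h1 : algebraMap R E ε = (σ : E →+* E) (algebraMap R E ε) :=
        (RingHom.congr_fun hσR ε).symm
      have h2 : algebraMap K E x = (σ : E →+* E) (algebraMap K E x) := (σ.commutes x).symm
      rw [h1, lineEval_biMap, h2, eval_map_apply, hA'0, map_zero]
    have hrel : IsRelPrime (biMap (σ : E →+* E) A') A' :=
      hσirr.isRelPrime_iff_not_dvd.2 fun hd =>
        hne (eq_of_monic_of_associated hσm hA'm (hσirr.associated_of_dvd hA'irr hd))
    have hprod := _root_.map_dvd (lineEval (algebraMap R E ε)) (hrel.mul_dvd hσd hA'd)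
    rw [map_mul, lineEval_biMap, ← hRKE, ← Polynomial.map_map] at hprod
    have hsq : (X - C (algebraMap K E x)) ^ 2 ∣
        ((lineEval ε H).map (algebraMap R K)).map (algebraMap K E) := by
      rw [pow_two]
      refine (mul_dvd_mul ?_ ?_).trans hprod
      · rw [dvd_iff_isRoot, hRKE]; exact hσ0
      · rw [dvd_iff_isRoot, hRKE]; exact hA'0
    refine hx2 ((map_dvd_map' (algebraMap K E)).1 ?_)
    simpa using hsq
  -- Hence the coefficients of `A'` lie in `K`; being integral, they lie in `R`.
  obtain ⟨B, rfl⟩ : ∃ B : R[X][Y], biMap (algebraMap R E) B = A' := by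
    refine exists_biMap_eq _ fun i j => ?_
    have hmem : (A'.coeff j).coeff i ∈ Set.range (algebraMap K E) := by
      rw [InfiniteGalois.mem_range_algebraMap_iff_fixed]
      intro σ
      have := congrArg (fun p : E[X][Y] => (p.coeff j).coeff i) (hfix σ)
      rwa [coeff_coeff_biMap] at this
    obtain ⟨y, hy⟩ := hmem
    have hyint : IsIntegral R y := by
      have := hint i j
      rw [coeff_coeff_biMap, ← hy, ← RingHom.comp_apply, hKEL] at this
      exact (isIntegral_algebraMap_iff (algebraMap K L).injective).1 this
    obtain ⟨z, hz⟩ := IsIntegrallyClosed.isIntegral_iff.1 hyint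
    exact ⟨z, by rw [← hy, ← hz, ← RingHom.comp_apply, hRKE]⟩
  rw [biMap_biMap, hREL] at hAirr hAm hAd
  have hBm := monic_of_monic_biMap hinj hAm
  exact ⟨B, hBm, hAirr, (biMap_dvd_biMap hinj hBm).1 hAd⟩

end Descent

/-! ### The factorisation over `ℂ` -/

theorem irreducible_of_leftInverse {M : Type*} [CommRing M] {f : M →+* M} (hf : ∀ x, f (f x) = x)
    {p : M} (hp : Irreducible p) : Irreducible (f p) := by
  let e : M ≃+* M := { f with invFun := f, left_inv := hf, right_inv := hf }
  exact (MulEquiv.irreducible_iff e).2 hp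

theorem eq_neg_one_pow_mul {M : Type*} [CommRing M] {x y : M} {d : ℕ} (h : y = (-1) ^ d * x) :
    x = (-1) ^ d * y := by
  rw [h, ← mul_assoc, ← mul_pow, neg_mul_neg, one_mul, one_pow, one_mul]

theorem monic_reflect {S : Type*} [CommRing S] [IsDomain S] {A : S[X][Y]} (hA : A.Monic) :
    ((-1) ^ A.natDegree * reflect S A).Monic ∧
      ((-1) ^ A.natDegree * reflect S A).natDegree = A.natDegree := by
  have hm : (A.map (compRingHom (-X) : S[X] →+* S[X])).Monic := hA.map _
  have hd : (A.map (compRingHom (-X) : S[X] →+* S[X])).natDegree = A.natDegree :=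
    hA.natDegree_map _
  have hX : (-(Y : S[X][Y])).natDegree = 1 := by rw [natDegree_neg, natDegree_X]
  have hr : reflect S A = (A.map (compRingHom (-X) : S[X] →+* S[X])).comp (-(Y : S[X][Y])) := rfl
  have hc : ((-1) ^ A.natDegree : S[X][Y]) = C ((-1) ^ A.natDegree) := by simp
  constructor
  · rw [Monic, leadingCoeff_mul, hr, leadingCoeff_comp (by rw [hX]; exact one_ne_zero), hm, hd, hc,
      leadingCoeff_C, leadingCoeff_neg, leadingCoeff_X, one_mul, ← mul_pow]
    simp
  · rw [hc, natDegree_C_mul (pow_ne_zero _ (neg_ne_zero.2 one_ne_zero)), hr, natDegree_comp, hd, hX,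
      mul_one]

theorem three_dvd_lineEval_of_dvd {S : Type*} [CommRing S] {A B : S[X][Y]} (hAB : A ∣ B) {ε : S}
    (h : 3 ∣ lineEval ε A) : 3 ∣ lineEval ε B :=
  h.trans (_root_.map_dvd _ hAB)

theorem toComplex_injective : Function.Injective GaussianInt.toComplex :=
  fun _ _ h => GaussianInt.toComplex_inj.1 h

theorem toComplex_gConj (x : GaussianInt) :
    GaussianInt.toComplex (gConj x) = starRingEnd ℂ (GaussianInt.toComplex x) :=
  GaussianInt.toComplex_star x

theorem biMap_toComplex_gConj (A : GaussianInt[X][Y]) :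
    biMap GaussianInt.toComplex (biMap gConj A) =
      biMap (starRingEnd ℂ) (biMap GaussianInt.toComplex A) := by
  rw [biMap_biMap, biMap_biMap]
  congr 1
  exact congrArg biMap (RingHom.ext toComplex_gConj)

theorem biMap_toComplex_toG (H : ℤ[X][Y]) :
    biMap GaussianInt.toComplex (toG H) = biMap (Int.castRingHom ℂ) H := by
  rw [biMap_biMap]
  exact congrArg (fun φ => biMap φ H) (RingHom.ext_int _ _)

theorem irreducible_biMap_conj {p : ℂ[X][Y]} (hp : Irreducible p) :
    Irreducible (biMap (starRingEnd ℂ) p) := by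
  refine irreducible_of_leftInverse (fun x => ?_) hp
  rw [biMap_biMap, show (starRingEnd ℂ).comp (starRingEnd ℂ) = RingHom.id ℂ from
    RingHom.ext Complex.conj_conj, biMap_id, RingHom.id_apply]

theorem irreducible_reflect {S : Type*} [CommRing S] {p : S[X][Y]} (hp : Irreducible p) :
    Irreducible (reflect S p) :=
  irreducible_of_leftInverse reflect_reflect hp

theorem dvd_or_dvd_of_irreducible_biMap {A P Q : GaussianInt[X][Y]} (hA : A.Monic)
    (hirr : Irreducible (biMap GaussianInt.toComplex A)) (h : A ∣ P * Q) : A ∣ P ∨ A ∣ Q := by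
  have h' := _root_.map_dvd (biMap GaussianInt.toComplex) h
  rw [map_mul] at h'
  exact (hirr.prime.dvd_or_dvd h').imp (biMap_dvd_biMap toComplex_injective hA).1
    (biMap_dvd_biMap toComplex_injective hA).1

/-- `A` is one of two absolutely irreducible factors of `H`, defined over `ℤ[i]` and exchanged both
by complex conjugation and, up to sign, by `(a, b) ↦ (-a, -b)`. -/
structure IsConjFactor (H : ℤ[X][Y]) (A : GaussianInt[X][Y]) : Prop where
  monic : A.Monic
  irreducible : Irreducible (biMap GaussianInt.toComplex A)
  mul_conj : A * biMap gConj A = toG H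
  reflect_eq : reflect GaussianInt A = (-1) ^ A.natDegree * biMap gConj A

namespace IsCore

variable {k : ℕ} {H : ℤ[X][Y]}

/-- `H` meets the line `b = a + i` transversally in a single point, with coordinates in `ℚ(i)`. -/
theorem exists_factor (hH : IsCore k H) : ∃ A : GaussianInt[X][Y], A.Monic ∧
    Irreducible (biMap GaussianInt.toComplex A) ∧ A ∣ toG H := by
  let _ : Algebra GaussianInt ℂ := GaussianInt.toComplex.toAlgebra
  have : FaithfulSMul GaussianInt ℂ :=
    (faithfulSMul_iff_algebraMap_injective _ _).2 toComplex_injective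
  let K := FractionRing GaussianInt
  let _ : Algebra K ℂ := FractionRing.liftAlgebra GaussianInt ℂ
  have : IsScalarTower GaussianInt K ℂ := FractionRing.isScalarTower_liftAlgebra GaussianInt ℂ
  have hinj : Function.Injective (algebraMap GaussianInt K) := IsFractionRing.injective _ _
  have : CharZero K := charZero_of_injective_algebraMap hinj
  obtain ⟨q, r, hq, hl⟩ := hH.line
  set ι : K := algebraMap GaussianInt K gI with hι
  have hι2 : ι ^ 2 = -1 := by rw [hι, ← map_pow, gI_sq]; simp
  have hι0 : ι ≠ 0 := by rintro h; rw [h] at hι2; simp at hι2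
  have hq0 : (q : K) ≠ 0 := by
    rw [Int.cast_ne_zero]; rintro rfl; exact hq (dvd_zero 3)
  have hline : (lineEval gI (toG H)).map (algebraMap GaussianInt K) =
      3 * (C (q * ι) * X + C (r : K)) := by
    rw [← lineEval_biMap, biMap_biMap, show (algebraMap GaussianInt K).comp
      (Int.castRingHom GaussianInt) = Int.castRingHom K from RingHom.ext_int _ _]
    exact hl K ι hι2
  refine exists_absolutely_irreducible_factor (R := GaussianInt) (K := K) (L := ℂ)
    (monic_biMap _ hH.monic) (ε := gI) (x := -r / (q * ι)) ?_ ?_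
  · rw [hline]
    simp only [eval_mul, eval_add, eval_C, eval_X, eval_ofNat]
    rw [mul_div_cancel₀ _ (mul_ne_zero hq0 hι0), neg_add_cancel, mul_zero]
  · rw [hline]
    intro hd
    have h3 : (3 : K[X]) = C 3 := (map_ofNat C 3).symm
    have hdeg : (C (q * ι) * X + C (r : K)).natDegree = 1 :=
      natDegree_linear (mul_ne_zero hq0 hι0)
    have h0 : (3 : K[X]) * (C (q * ι) * X + C (r : K)) ≠ 0 := by
      refine mul_ne_zero (by norm_num) fun h => ?_
      rw [h] at hdeg; simp at hdeg
    have := natDegree_le_of_dvd hd h0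
    rw [natDegree_pow, natDegree_X_sub_C, h3, natDegree_C_mul (by norm_num), hdeg] at this
    omega

theorem irreducible_or_exists_isConjFactor (hH : IsCore k H) :
    Irreducible (biMap (Int.castRingHom ℂ) H) ∨ ∃ A, IsConjFactor H A := by
  obtain ⟨A, hA, hirr, B, hAB⟩ := hH.exists_factor
  have hHm : (toG H).Monic := monic_biMap _ hH.monic
  have hB : B.Monic := hA.of_mul_monic_left (hAB ▸ hHm)
  by_cases hB1 : B = 1
  · left
    rwa [← biMap_toComplex_toG, hAB, hB1, mul_one]
  right
  have hA1 : A ≠ 1 := by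
    rintro rfl
    exact hirr.not_isUnit (by rw [map_one]; exact isUnit_one)
  have hdA : A ∣ toG H := ⟨B, hAB⟩
  have hdB : B ∣ toG H := ⟨A, hAB.trans (mul_comm _ _)⟩
  -- Modulo `3` one of the factors is a power of `b - a - ε`, the other one of `b - a + ε`.
  obtain ⟨ε, hε, hεc, hone, hAε⟩ : ∃ ε : GaussianInt, ε ^ 2 = -1 ∧ gConj ε = -ε ∧
      (∀ D : GaussianInt[X][Y], D.Monic → D ∣ toG H → ¬ 3 ∣ lineEval ε D →
        ¬ 3 ∣ lineEval (-ε) D → D = 1) ∧ 3 ∣ lineEval ε A := by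
    by_cases h : 3 ∣ lineEval gI A
    · exact ⟨gI, gI_sq, gConj_gI, fun D => hH.eq_one_of_dvd, h⟩
    · refine ⟨-gI, neg_gI_sq, by rw [map_neg, gConj_gI], fun D h1 h2 h3 h4 => ?_, ?_⟩
      · rw [neg_neg] at h4; exact hH.eq_one_of_dvd h1 h2 h4 h3
      · by_contra h'
        exact hA1 (hH.eq_one_of_dvd hA hdA h h')
  have hε' : (-ε) ^ 2 = -1 := by rw [neg_sq, hε]
  have hBε : ¬ 3 ∣ lineEval ε B := hH.not_three_dvd hAB.symm hε hAε
  have hBε' : 3 ∣ lineEval (-ε) B := by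
    by_contra h
    exact hB1 (hone B hB hdB hBε h)
  have hAε' : ¬ 3 ∣ lineEval (-ε) A :=
    hH.not_three_dvd (by rw [mul_comm, ← hAB]) hε' hBε'
  -- The conjugate of `A` is another irreducible factor, so it is `B`.
  have hcm : (biMap gConj A).Monic := monic_biMap _ hA
  have hcε' : 3 ∣ lineEval (-ε) (biMap gConj A) := by
    rw [← hεc, three_dvd_lineEval_gConj]; exact hAε
  have hcd : biMap gConj A ∣ A * B := by
    rw [← hAB, ← biMap_gConj_toG]; exact _root_.map_dvd _ hdA
  have hcB : biMap gConj A = B := by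
    have hcirr : Irreducible (biMap GaussianInt.toComplex (biMap gConj A)) := by
      rw [biMap_toComplex_gConj]; exact irreducible_biMap_conj hirr
    obtain ⟨Q, hQ⟩ := (dvd_or_dvd_of_irreducible_biMap hcm hcirr hcd).resolve_left
      fun h => hAε' (three_dvd_lineEval_of_dvd h hcε')
    have hQm : Q.Monic := hcm.of_mul_monic_left (hQ ▸ hB)
    have hQB : Q ∣ B := ⟨_, hQ.trans (mul_comm _ _)⟩
    have hQ1 : Q = 1 := by
      refine hone Q hQm (hQB.trans hdB) (fun h => hBε (three_dvd_lineEval_of_dvd hQB h))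
        fun h => ?_
      refine hH.not_three_dvd (A := biMap gConj A) (B := A * Q) ?_ hε' hcε'
        (three_dvd_lineEval_of_dvd (dvd_mul_left Q A) h)
      rw [hAB, hQ]; ring
    rw [hQ, hQ1, mul_one]
  subst hcB
  refine ⟨A, hA, hirr, hAB.symm, ?_⟩
  -- So is, up to sign, the reflection of `A`.
  obtain ⟨hrm, hrd⟩ := monic_reflect hA
  have hunit : IsUnit ((-1 : GaussianInt[X][Y]) ^ A.natDegree) :=
    (isUnit_one (M := GaussianInt[X][Y])).neg.pow _
  have hrd' : (-1) ^ A.natDegree * reflect GaussianInt A ∣ A * biMap gConj A := by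
    rw [hunit.mul_left_dvd, ← hAB]
    have : reflect GaussianInt (toG H) = toG H := by rw [reflect_biMap, hH.reflect_eq]
    rw [← this]
    exact _root_.map_dvd _ hdA
  have hrirr : Irreducible (biMap GaussianInt.toComplex
      ((-1) ^ A.natDegree * reflect GaussianInt A)) := by
    rw [map_mul, ← reflect_biMap, irreducible_isUnit_mul (hunit.map _)]
    exact irreducible_reflect hirr
  have hrε : 3 ∣ lineEval (-ε) ((-1) ^ A.natDegree * reflect GaussianInt A) := by
    refine three_dvd_lineEval_of_dvd (dvd_mul_left _ _) ?_
    rw [three_dvd_lineEval_reflect, neg_neg]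
    exact hAε
  have hdvd := (dvd_or_dvd_of_irreducible_biMap hrm hrirr hrd').resolve_left
      fun h => hAε' (three_dvd_lineEval_of_dvd h hrε)
  have heq := eq_of_monic_of_dvd_of_natDegree_le hrm hcm hdvd
    (by rw [hrd, natDegree_biMap _ hA])
  exact eq_neg_one_pow_mul heq

end IsCore

/-! ### Finiteness of intersections of plane curves -/

/-- Two plane curves without a common component meet over finitely many values of `a`: a nonzero
polynomial in `a` lies in the ideal generated by their equations. -/
theorem exists_elimination {R : Type*} [CommRing R] [IsDomain R] [UniqueFactorizationMonoid R]
    {H g : R[X][Y]} (hm : H.Monic) (hirr : Irreducible H) (hg : ¬ H ∣ g) :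
    ∃ r : R[X], r ≠ 0 ∧ ∃ x y, C r = g * x + H * y := by
  have := AdjoinRoot.isDomain_of_prime hirr.prime
  have := hm.finite_adjoinRoot
  have hg0 : AdjoinRoot.mk H g ≠ 0 := by rwa [Ne, AdjoinRoot.mk_eq_zero]
  have hinj : Function.Injective (algebraMap R[X] (AdjoinRoot H)) := by
    refine AdjoinRoot.of.injective_of_degree_ne_zero fun h => ?_
    rw [degree_eq_natDegree hm.ne_zero] at h
    exact hirr.not_isUnit (by
      rw [hm.natDegree_eq_zero.1 (by exact_mod_cast h)]; exact isUnit_one)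
  have : FaithfulSMul R[X] (AdjoinRoot H) := (faithfulSMul_iff_algebraMap_injective _ _).2 hinj
  have hint : IsIntegral R[X] (AdjoinRoot.mk H g) := Algebra.IsIntegral.isIntegral _
  obtain ⟨r, hr, s, hs⟩ := hint.isAlgebraic.exists_nonzero_dvd (mem_nonZeroDivisors_of_ne_zero hg0)
  obtain ⟨x, rfl⟩ := AdjoinRoot.mk_surjective s
  refine ⟨r, hr, x, ?_⟩
  have : AdjoinRoot.mk H (C r - g * x) = 0 := by
    rw [map_sub, map_mul, ← hs, AdjoinRoot.algebraMap_eq, AdjoinRoot.mk_C, sub_self]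
  obtain ⟨y, hy⟩ := AdjoinRoot.mk_eq_zero.1 this
  exact ⟨y, by rw [← hy]; ring⟩

theorem evalEval_eq (p : ℂ[X][Y]) (x y : ℂ) :
    p.evalEval x y = (p.map (evalRingHom x)).eval y :=
  (map_evalRingHom_eval x y p).symm

theorem finite_inter_zeroSet {R : Type*} [CommRing R] [IsDomain R] [UniqueFactorizationMonoid R]
    {φ : R →+* ℂ} (hφ : Function.Injective φ) {H g : R[X][Y]} (hm : H.Monic)
    (hirr : Irreducible H) (hg : ¬ H ∣ g) :
    (zeroSet (biMap φ H) ∩ zeroSet (biMap φ g)).Finite := by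
  obtain ⟨r, hr, x, y, hxy⟩ := exists_elimination hm hirr hg
  have hr' : r.map φ ≠ 0 := (Polynomial.map_ne_zero_iff hφ).2 hr
  refine ((rootSet_finite (r.map φ) ℂ).biUnion fun a _ =>
    (Set.finite_singleton a).prod (rootSet_finite ((biMap φ H).map (evalRingHom a)) ℂ)).subset ?_
  rintro ⟨a, b⟩ ⟨hH, hg⟩
  simp only [zeroSet, Set.mem_ofPred_eq] at hH hg
  simp only [Set.mem_iUnion, Set.mem_prod, Set.mem_singleton_iff]
  refine ⟨a, ?_, rfl, ?_⟩
  · rw [mem_rootSet]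
    refine ⟨hr', ?_⟩
    have := congrArg (fun p => evalEval a b (biMap φ p)) hxy
    simp only [map_add, map_mul, evalEval_add, evalEval_mul, hH, hg, zero_mul, add_zero] at this
    have h2 : biMap φ (C r) = C (r.map φ) := by simp [biMap]
    rw [h2, evalEval_C] at this
    simpa using this
  · rw [mem_rootSet]
    refine ⟨((monic_biMap φ hm).map _).ne_zero, ?_⟩
    rw [evalEval_eq] at hH
    simpa using hH

/-! ### The Zariski topology of `M₃` -/

theorem isClosed_zariski_iff {n : ℕ} {Z : Set (Fin n → ℂ)} : @IsClosed _ (zariskiTopology n) Z ↔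
    ∃ I : Ideal (MvPolynomial (Fin n) ℂ), Z = MvPolynomial.zeroLocus ℂ I := by
  rw [← @isOpen_compl_iff _ _ (zariskiTopology n)]
  change Zᶜᶜ ∈ _ ↔ _
  rw [compl_compl]
  rfl

theorem isClosed_M3_iff {Z : Set M3} : IsClosed Z ↔
    ∃ I : Ideal (MvPolynomial (Fin 3) ℂ), Z = veronese ⁻¹' MvPolynomial.zeroLocus ℂ I := by
  rw [@isClosed_induced_iff _ _ (zariskiTopology 3)]
  constructor
  · rintro ⟨t, ht, rfl⟩
    obtain ⟨I, rfl⟩ := isClosed_zariski_iff.1 ht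
    exact ⟨I, rfl⟩
  · rintro ⟨I, rfl⟩
    exact ⟨_, isClosed_zariski_iff.2 ⟨I, rfl⟩, rfl⟩

theorem veronese_toM3 (a b : ℂ) : veronese (toM3 (a, b)) = ![a ^ 2, a * b, b ^ 2] := rfl

theorem toM3_neg (p : ℂ × ℂ) : toM3 (-p) = toM3 p := Quotient.sound (Or.inr rfl)

theorem toM3_surjective : Function.Surjective toM3 := Quotient.mk_surjective

theorem veronese_injective : Function.Injective veronese := by
  intro x y h
  obtain ⟨⟨a, b⟩, rfl⟩ := toM3_surjective x
  obtain ⟨⟨c, d⟩, rfl⟩ := toM3_surjective y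
  rw [veronese_toM3, veronese_toM3] at h
  have h0 : a ^ 2 = c ^ 2 := congrFun h 0
  have h1 : a * b = c * d := congrFun h 1
  have h2 : b ^ 2 = d ^ 2 := congrFun h 2
  have key : (a, b) = (c, d) ∨ (a, b) = -(c, d) := by
    simp only [Prod.neg_mk, Prod.mk.injEq]
    rcases sq_eq_sq_iff_eq_or_eq_neg.1 h0 with rfl | rfl
    · by_cases ha : a = 0
      · subst ha
        simpa using sq_eq_sq_iff_eq_or_eq_neg.1 h2
      · exact Or.inl ⟨rfl, mul_left_cancel₀ ha h1⟩
    · by_cases hc : c = 0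
      · subst hc
        simpa using sq_eq_sq_iff_eq_or_eq_neg.1 h2
      · refine Or.inr ⟨rfl, mul_left_cancel₀ hc ?_⟩
        linear_combination -h1
  exact Quotient.sound key

instance : T1Space M3 where
  t1 x := by
    rw [isClosed_M3_iff]
    refine ⟨MvPolynomial.vanishingIdeal ℂ {veronese x}, ?_⟩
    ext y
    simp only [Set.mem_singleton_iff, Set.mem_preimage, MvPolynomial.mem_zeroLocus_iff]
    constructor
    · rintro rfl p hp
      exact hp _ rfl
    · intro h
      refine veronese_injective (funext fun i => ?_)
      have := h (MvPolynomial.X i - MvPolynomial.C (veronese x i)) (by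
        rintro _ rfl
        simp)
      simpa [sub_eq_zero] using this

/-- The pullback of a polynomial function on `ℂ³` along the Veronese map. -/
theorem exists_evalEval_eq_aeval_veronese (P : MvPolynomial (Fin 3) ℂ) :
    ∃ F : ℂ[X][Y], ∀ p : ℂ × ℂ, F.evalEval p.1 p.2 = MvPolynomial.aeval (veronese (toM3 p)) P := by
  refine ⟨MvPolynomial.aeval ![C X ^ 2, C X * Y, Y ^ 2] P, fun ⟨a, b⟩ => ?_⟩
  have h : (evalEvalRingHom a b).comp
      (MvPolynomial.aeval (R := ℂ) ![(C X : ℂ[X][Y]) ^ 2, C X * Y, Y ^ 2]).toRingHom =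
      (MvPolynomial.aeval (R := ℂ) (veronese (toM3 (a, b)))).toRingHom := by
    refine MvPolynomial.ringHom_ext (fun z => ?_) fun i => ?_
    · simp
    · rw [veronese_toM3]
      fin_cases i
      · simp
      · simp [mul_comm b a]
      · simp
  exact RingHom.congr_fun h P

/-- Every polynomial in `a, b` has the form `P₀ + a P₁ + b P₂` with `Pᵢ` polynomials in
`a², ab, b²`. -/
theorem exists_even_odd_decomposition (F : ℂ[X][Y]) : ∃ P₀ P₁ P₂ : MvPolynomial (Fin 3) ℂ,
    ∀ a b : ℂ, F.evalEval a b = MvPolynomial.aeval ![a ^ 2, a * b, b ^ 2] P₀ +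
      a * MvPolynomial.aeval ![a ^ 2, a * b, b ^ 2] P₁ +
      b * MvPolynomial.aeval ![a ^ 2, a * b, b ^ 2] P₂ := by
  let x : MvPolynomial (Fin 3) ℂ := MvPolynomial.X 0
  let y : MvPolynomial (Fin 3) ℂ := MvPolynomial.X 1
  let z : MvPolynomial (Fin 3) ℂ := MvPolynomial.X 2
  induction F using Polynomial.induction_on' with
  | add p q hp hq =>
    obtain ⟨P₀, P₁, P₂, hP⟩ := hp
    obtain ⟨Q₀, Q₁, Q₂, hQ⟩ := hq
    refine ⟨P₀ + Q₀, P₁ + Q₁, P₂ + Q₂, fun a b => ?_⟩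
    rw [evalEval_add, hP, hQ]; simp only [map_add]; ring
  | monomial n c =>
    induction n with
    | zero =>
      rw [monomial_zero_left]
      induction c using Polynomial.induction_on' with
      | add p q hp hq =>
        obtain ⟨P₀, P₁, P₂, hP⟩ := hp
        obtain ⟨Q₀, Q₁, Q₂, hQ⟩ := hq
        refine ⟨P₀ + Q₀, P₁ + Q₁, P₂ + Q₂, fun a b => ?_⟩
        rw [C_add, evalEval_add, hP, hQ]; simp only [map_add]; ring
      | monomial m c =>
        induction m with
        | zero => exact ⟨MvPolynomial.C c, 0, 0, fun a b => by simp⟩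
        | succ m ih =>
          obtain ⟨P₀, P₁, P₂, hP⟩ := ih
          refine ⟨x * P₁ + y * P₂, P₀, 0, fun a b => ?_⟩
          have := hP a b
          rw [evalEval_C] at this ⊢
          rw [← monomial_mul_X, eval_mul, this]
          simp [x, y]; ring
    | succ n ih =>
      obtain ⟨P₀, P₁, P₂, hP⟩ := ih
      refine ⟨y * P₁ + z * P₂, 0, P₀, fun a b => ?_⟩
      rw [← monomial_mul_X, evalEval_mul, hP, evalEval_X]
      simp [y, z]; ring

theorem evalEval_reflect (t : ℂ[X][Y]) (a b : ℂ) :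
    (reflect ℂ t).evalEval a b = t.evalEval (-a) (-b) := by
  have : (evalEvalRingHom a b).comp (reflect ℂ) = evalEvalRingHom (-a) (-b) :=
    hom_ext_bivariate (by simp) (by simp) (by simp)
  exact RingHom.congr_fun this t

theorem toM3_image_zeroSet_reflect (t : ℂ[X][Y]) :
    toM3 '' zeroSet (reflect ℂ t) = toM3 '' zeroSet t := by
  ext x
  constructor
  · rintro ⟨p, hp, rfl⟩
    refine ⟨-p, ?_, toM3_neg p⟩
    simpa [zeroSet, evalEval_reflect] using hp
  · rintro ⟨p, hp, rfl⟩
    refine ⟨-p, ?_, toM3_neg p⟩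
    simpa [zeroSet, evalEval_reflect] using hp

/-- The image of a plane curve in `M₃` is closed: `t(a, b) t(-a, -b)` is a polynomial in
`a², ab, b²`. -/
theorem isClosed_toM3_image_zeroSet (t : ℂ[X][Y]) : IsClosed (toM3 '' zeroSet t) := by
  obtain ⟨P₀, P₁, P₂, hP⟩ := exists_even_odd_decomposition t
  let x : MvPolynomial (Fin 3) ℂ := MvPolynomial.X 0
  let y : MvPolynomial (Fin 3) ℂ := MvPolynomial.X 1
  let z : MvPolynomial (Fin 3) ℂ := MvPolynomial.X 2
  let Q := P₀ ^ 2 - (x * P₁ ^ 2 + 2 * y * P₁ * P₂ + z * P₂ ^ 2)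
  have hQ : ∀ a b : ℂ, MvPolynomial.aeval ![a ^ 2, a * b, b ^ 2] Q =
      t.evalEval a b * t.evalEval (-a) (-b) := by
    intro a b
    rw [hP, hP]
    simp only [neg_mul_neg, neg_sq]
    simp [Q, x, y, z]; ring
  rw [isClosed_M3_iff]
  refine ⟨Ideal.span {Q}, ?_⟩
  rw [MvPolynomial.zeroLocus_span]
  ext w
  obtain ⟨⟨a, b⟩, rfl⟩ := toM3_surjective w
  simp only [Set.mem_preimage, veronese_toM3, Set.mem_singleton_iff, forall_eq, Set.mem_ofPred_eq,
    hQ, mul_eq_zero]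
  constructor
  · rintro ⟨⟨c, d⟩, hcd, h⟩
    rcases Quotient.exact h with h | h
    · rw [h] at hcd
      exact Or.inl hcd
    · simp only [Prod.neg_mk, Prod.mk.injEq] at h
      obtain ⟨rfl, rfl⟩ := h
      exact Or.inr hcd
  · rintro (h | h)
    · exact ⟨(a, b), h, rfl⟩
    · exact ⟨(-a, -b), h, toM3_neg (a, b)⟩

/-! ### Irreducibility and dimension of the image of an irreducible plane curve -/

section Topology

variable {M : Type*} [TopologicalSpace M] {S : Set M}

theorem isIrreducible_of_infinite_inter (hinf : S.Infinite)
    (h : ∀ Z, IsClosed Z → (Z ∩ S).Infinite → S ⊆ Z) : IsIrreducible S := by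
  refine ⟨hinf.nonempty, ?_⟩
  rw [isPreirreducible_iff_isClosed_union_isClosed]
  intro Z₁ Z₂ h₁ h₂ hS
  have : ((Z₁ ∩ S) ∪ (Z₂ ∩ S)).Infinite := by
    rwa [← Set.union_inter_distrib_right, Set.inter_eq_right.2 hS]
  rcases Set.infinite_union.1 this with h' | h'
  · exact Or.inl (h Z₁ h₁ h')
  · exact Or.inr (h Z₂ h₂ h')

theorem subsingleton_of_finite_of_isPreirreducible [T1Space M] {Z : Set M} (hf : Z.Finite)
    (hZ : IsPreirreducible Z) : Z.Subsingleton := by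
  intro x hx y hy
  by_contra hne
  rw [isPreirreducible_iff_isClosed_union_isClosed] at hZ
  rcases hZ {x} (Z \ {x}) isClosed_singleton (hf.subset Set.sdiff_subset).isClosed
    (by rw [Set.union_sdiff_self]; exact Set.subset_union_right) with h | h
  · exact hne (h hy).symm
  · exact (h hx).2 rfl

theorem topologicalKrullDim_eq_one_of_infinite_inter [T1Space M] (hinf : S.Infinite)
    (h : ∀ Z, IsClosed Z → (Z ∩ S).Infinite → S ⊆ Z) : topologicalKrullDim S = 1 := by
  have : Infinite S := hinf.to_subtype
  have hirr : IsIrreducible (Set.univ : Set S) := by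
    have := (isIrreducible_iff_irreducibleSpace (s := S)).1 (isIrreducible_of_infinite_inter hinf h)
    exact IrreducibleSpace.isIrreducible_univ S
  have huniv : ∀ Z : Set S, IsClosed Z → Z.Infinite → Z = Set.univ := by
    intro Z hZ hZinf
    obtain ⟨W, hW, rfl⟩ := isClosed_induced_iff.1 hZ
    have hWS : (W ∩ S).Infinite := by
      have := hZinf.image (f := Subtype.val) Subtype.val_injective.injOn
      rwa [Subtype.image_preimage_coe, Set.inter_comm] at this
    exact Set.eq_univ_of_forall fun x => h W hW hWS x.2
  refine le_antisymm ?_ ?_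
  · rw [topologicalKrullDim, Order.krullDim_le_one_iff]
    intro Z
    by_cases hZ : (Z : Set S).Finite
    · left
      intro W hWZ x hx
      have hsub := subsingleton_of_finite_of_isPreirreducible hZ Z.isIrreducible.isPreirreducible
      obtain ⟨y, hy⟩ := W.isIrreducible.nonempty
      have : x = y := hsub hx (hWZ hy)
      rwa [this]
    · right
      intro W _ x _
      have := huniv Z Z.isClosed hZ
      change x ∈ (Z : Set S)
      rw [this]
      exact Set.mem_univ x
  · rw [topologicalKrullDim, Order.one_le_krullDim_iff]
    obtain ⟨x, -⟩ := hirr.nonempty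
    refine ⟨{x}, ⟨Set.univ, hirr, isClosed_univ⟩, lt_of_le_of_ne (fun y _ => Set.mem_univ y) ?_⟩
    intro heq
    obtain ⟨y, hy⟩ := exists_ne x
    have : y ∈ ({x} : TopologicalSpace.IrreducibleCloseds S) := heq ▸ Set.mem_univ y
    exact hy this

theorem closure_eq_of_infinite_inter (hinf : S.Infinite) (hcl : IsClosed S)
    (h : ∀ Z, IsClosed Z → (Z ∩ S).Infinite → S ⊆ Z) {W : Set M} (hW : W ⊆ S)
    (hfin : (S \ W).Finite) : closure W = S := by
  refine subset_antisymm (closure_minimal hW hcl) (h _ isClosed_closure fun hf => hinf ?_)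
  refine (hf.union hfin).subset fun x hx => ?_
  by_cases hxW : x ∈ W
  · exact Or.inl ⟨subset_closure hxW, hx⟩
  · exact Or.inr ⟨hx, hxW⟩

end Topology

theorem infinite_toM3_image_zeroSet {t : ℂ[X][Y]} (hm : t.Monic) (hirr : Irreducible t) :
    (toM3 '' zeroSet t).Infinite := by
  intro hfin
  refine Set.infinite_univ (α := ℂ) ((hfin.image fun x => veronese x 0).subset fun c _ => ?_)
  obtain ⟨a, ha⟩ := IsAlgClosed.exists_pow_nat_eq c (n := 2) (by norm_num)
  have hdeg : (t.map (evalRingHom a)).degree ≠ 0 := by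
    rw [hm.degree_map, degree_eq_natDegree hm.ne_zero]
    intro h
    exact hirr.not_isUnit (by
      rw [hm.natDegree_eq_zero.1 (by exact_mod_cast h)]; exact isUnit_one)
  obtain ⟨b, hb⟩ := IsAlgClosed.exists_root _ hdeg
  refine ⟨toM3 (a, b), ⟨(a, b), ?_, rfl⟩, ?_⟩
  · change t.evalEval a b = 0
    rw [evalEval_eq]; exact hb
  · simp [veronese_toM3, ha]

theorem toM3_image_zeroSet_subset {t : ℂ[X][Y]} (hm : t.Monic) (hirr : Irreducible t) {Z : Set M3}
    (hZ : IsClosed Z) (hinf : (Z ∩ toM3 '' zeroSet t).Infinite) : toM3 '' zeroSet t ⊆ Z := by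
  obtain ⟨I, rfl⟩ := isClosed_M3_iff.1 hZ
  rintro _ ⟨p, hp, rfl⟩ P hP
  obtain ⟨F, hF⟩ := exists_evalEval_eq_aeval_veronese P
  rw [← hF]
  have hd : t ∣ F := by
    by_contra hd
    have hfin := finite_inter_zeroSet (RingHom.id ℂ).injective hm hirr hd
    rw [biMap_id, RingHom.id_apply, RingHom.id_apply] at hfin
    refine hinf ((hfin.image toM3).subset ?_)
    rintro _ ⟨hx, q, hq, rfl⟩
    exact ⟨q, ⟨hq, (hF q).trans (hx P hP)⟩, rfl⟩
  obtain ⟨u, rfl⟩ := hd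
  rw [evalEval_mul, show t.evalEval p.1 p.2 = 0 from hp, zero_mul]

/-! ### The curve `Σ_{k,2}` -/

theorem evalEval_critIter (p : ℂ × ℂ) (m : ℕ) :
    (biMap (Int.castRingHom ℂ) (critIter m)).evalEval p.1 p.2 = (cubicMap p.1 p.2)^[m] p.1 := by
  induction m with
  | zero => simp [critIter_zero, evalEval_C]
  | succ m ih =>
    rw [critIter_succ, Function.iterate_succ_apply', ← ih, ← coe_evalEvalRingHom]
    simp only [map_add, map_sub, map_mul, map_pow, map_ofNat, biMap_C_X, biMap_Y, cubicMap]
    simp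

theorem mem_zeroSet_fPoly_iff (p : ℂ × ℂ) (k n : ℕ) :
    p ∈ zeroSet (biMap (Int.castRingHom ℂ) (fPoly k n)) ↔
      (cubicMap p.1 p.2)^[k + n] p.1 = (cubicMap p.1 p.2)^[k] p.1 := by
  rw [zeroSet, Set.mem_ofPred_eq, fPoly, map_sub, evalEval_sub, evalEval_critIter,
    evalEval_critIter, sub_eq_zero]

theorem zeroSet_subset_of_dvd {p q : ℂ[X][Y]} (h : p ∣ q) : zeroSet p ⊆ zeroSet q := by
  obtain ⟨r, rfl⟩ := h
  intro x hx
  rw [zeroSet, Set.mem_ofPred_eq] at hx ⊢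
  rw [evalEval_mul, hx, zero_mul]

/-- The strictly preperiodic parameters lie on `h_{k,n} = 0`. -/
theorem strictLocus_subset {k n : ℕ} (hn : 1 ≤ n) (hf : (fPoly k n).Monic) :
    strictLocus k n ⊆ toM3 '' zeroSet (hPolyC k n) := by
  rintro _ ⟨p, ⟨hp, hstrict⟩, rfl⟩
  refine ⟨p, ?_, rfl⟩
  obtain ⟨hlm, hlf, -, hpr⟩ := exists_lowerPart_mul hf
  rw [← mem_zeroSet_fPoly_iff, hlf, map_mul, zeroSet, Set.mem_ofPred_eq, evalEval_mul,
    mul_eq_zero] at hp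
  refine hp.resolve_left fun h0 => ?_
  let ev : ℤ[X][Y] →+* ℂ := (evalEvalRingHom p.1 p.2).comp (biMap (Int.castRingHom ℂ))
  have hev : ev (lowerPart k n) = 0 := h0
  obtain ⟨s, hs, v, hv⟩ := UniqueFactorizationMonoid.exists_prime_factors _ hlm.ne_zero
  rw [← hv, map_mul, mul_eq_zero] at hev
  replace hev := hev.resolve_right (v.isUnit.map ev).ne_zero
  rw [map_multiset_prod, Multiset.prod_eq_zero_iff, Multiset.mem_map] at hev
  obtain ⟨q, hq, hq0⟩ := hev
  obtain ⟨g, hg, hqg⟩ := hpr q (hs q hq)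
    ((Multiset.dvd_prod hq).trans ⟨_, hv.symm⟩)
  obtain ⟨-, -, l, m, ⟨h1, h2, h3, h4⟩, hgf⟩ := mem_lowerFactors.1 hg
  refine hstrict l m h1 h2 (Nat.le_of_dvd hn h3) h4 ((mem_zeroSet_fPoly_iff p l m).1 ?_)
  exact zeroSet_subset_of_dvd (_root_.map_dvd (biMap (Int.castRingHom ℂ)) (hqg.trans hgf)) hq0

/-- Only finitely many points of `h_{k,2} = 0` are not strictly preperiodic. -/
theorem finite_diff_strictLocus {k : ℕ} {H : ℤ[X][Y]} (hm : H.Monic) (hirr : Irreducible H)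
    (hd : H ∣ fPoly k 2) (hlow : ∀ l m, IsLower k 2 l m → ¬ H ∣ fPoly l m) :
    (toM3 '' zeroSet (biMap (Int.castRingHom ℂ) H) \ strictLocus k 2).Finite := by
  have hfin : ((⋃ i ∈ {i : ℕ × ℕ | IsLower k 2 i.1 i.2},
      toM3 '' (zeroSet (biMap (Int.castRingHom ℂ) H) ∩
        zeroSet (biMap (Int.castRingHom ℂ) (fPoly i.1 i.2)))) : Set M3).Finite := by
    refine Set.Finite.biUnion ?_ fun i hi => Set.Finite.image _ ?_
    · refine ((Set.finite_Iic k).prod (Set.finite_Iic 2)).subset fun i hi => ?_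
      exact ⟨hi.1, Nat.le_of_dvd (by norm_num) hi.2.2.1⟩
    · exact finite_inter_zeroSet (RingHom.injective_int _) hm hirr (hlow _ _ hi)
  refine hfin.subset ?_
  rintro _ ⟨⟨p, hp, rfl⟩, hns⟩
  by_contra hnot
  refine hns ⟨p, ⟨?_, fun l m hl h1 h2 hne heq => hnot ?_⟩, rfl⟩
  · exact (mem_zeroSet_fPoly_iff p k 2).1 (zeroSet_subset_of_dvd (_root_.map_dvd _ hd) hp)
  · refine Set.mem_biUnion (x := (l, m)) ⟨hl, h1, ?_, hne⟩
      ⟨p, ⟨hp, (mem_zeroSet_fPoly_iff p l m).2 heq⟩, rfl⟩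
    change m ∣ 2
    interval_cases m <;> norm_num

theorem sigmaCurve_eq {k : ℕ} {t : ℂ[X][Y]} (hm : (hPoly k 2).Monic)
    (hirr : Irreducible (hPoly k 2)) (hd : hPoly k 2 ∣ fPoly k 2)
    (hlow : ∀ l m, IsLower k 2 l m → ¬ hPoly k 2 ∣ fPoly l m) (ht : t.Monic)
    (htirr : Irreducible t) (himg : toM3 '' zeroSet (hPolyC k 2) = toM3 '' zeroSet t) :
    SigmaCurve k 2 = toM3 '' zeroSet t ∧ IsIrreducible (SigmaCurve k 2) ∧
      topologicalKrullDim (SigmaCurve k 2) = 1 := by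
  have hinf := infinite_toM3_image_zeroSet ht htirr
  have hZ := fun Z => toM3_image_zeroSet_subset ht htirr (Z := Z)
  have heq : SigmaCurve k 2 = toM3 '' zeroSet t := by
    refine closure_eq_of_infinite_inter hinf (isClosed_toM3_image_zeroSet t) hZ ?_ ?_
    · rw [← himg]
      exact strictLocus_subset (by norm_num) (fPoly_monic_natDegree k 1).1
    · rw [← himg]
      exact finite_diff_strictLocus hm hirr hd hlow
  rw [heq]
  exact ⟨rfl, isIrreducible_of_infinite_inter hinf hZ,
    topologicalKrullDim_eq_one_of_infinite_inter hinf hZ⟩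

theorem zeroSet_mul (p q : ℂ[X][Y]) : zeroSet (p * q) = zeroSet p ∪ zeroSet q := by
  ext x
  simp [zeroSet]

theorem zeroSet_C_C_mul {c : ℂ} (hc : c ≠ 0) (p : ℂ[X][Y]) :
    zeroSet (C (C c) * p) = zeroSet p := by
  ext x
  simp [zeroSet, hc, evalEval_C]

/-- Rescaling by a suitable `c ∈ {1, i}` turns `A(-a, -b) = (-1)ᵈ Ā` into `t(-a, -b) = t̄`. -/
theorem exists_mul_neg_one_pow_eq_gConj (d : ℕ) :
    ∃ c : GaussianInt, c * gConj c = 1 ∧ c * (-1) ^ d = gConj c := by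
  rcases Nat.even_or_odd d with h | h
  · exact ⟨1, by simp, by simp [h.neg_one_pow]⟩
  · refine ⟨gI, ?_, ?_⟩
    · rw [gConj_gI]; linear_combination -gI_sq
    · rw [gConj_gI, h.neg_one_pow]; ring

theorem hasGaussianCoeffs_biMap (p : GaussianInt[X][Y]) :
    HasGaussianCoeffs (biMap GaussianInt.toComplex p) := by
  intro i j
  refine ⟨((p.coeff j).coeff i).re, ((p.coeff j).coeff i).im, ?_⟩
  rw [coeff_coeff_biMap, GaussianInt.toComplex_def, Rat.cast_intCast, Rat.cast_intCast]

/-- The conclusion for `Σ_{k,2}`, from the factorisation of `H = h_{k,2}` over `ℂ`. -/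
theorem sigmaCurve_two {k : ℕ} {H : ℤ[X][Y]} (hH : hPoly k 2 = H) (hm : H.Monic)
    (hirr : Irreducible H) (hd : H ∣ fPoly k 2)
    (hlow : ∀ l m, IsLower k 2 l m → ¬ H ∣ fPoly l m)
    (hfac : Irreducible (biMap (Int.castRingHom ℂ) H) ∨ ∃ A, IsConjFactor H A) :
    IsIrreducible (SigmaCurve k 2) ∧ topologicalKrullDim (SigmaCurve k 2) = 1 ∧
    (Irreducible (hPolyC k 2) ∨
      ∃ t : ℂ[X][Y],
        Irreducible t ∧ Irreducible (conjPoly t) ∧ HasGaussianCoeffs t ∧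
        hPolyC k 2 = t * conjPoly t ∧ negArgs t = conjPoly t ∧
        toM3 '' zeroSet t = SigmaCurve k 2 ∧ toM3 '' zeroSet (conjPoly t) = SigmaCurve k 2) := by
  subst hH
  rcases hfac with hC | ⟨A, hA⟩
  · have h := sigmaCurve_eq hm hirr hd hlow (monic_biMap _ hm) hC rfl
    exact ⟨h.2.1, h.2.2, Or.inl hC⟩
  set φ := biMap GaussianInt.toComplex with hφ
  obtain ⟨c, hc1, hc2⟩ := exists_mul_neg_one_pow_eq_gConj A.natDegree
  have hc0 : GaussianInt.toComplex c ≠ 0 := by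
    rw [Ne, GaussianInt.toComplex_eq_zero]
    rintro rfl
    simp at hc1
  have hcu : IsUnit (C (C (GaussianInt.toComplex c)) : ℂ[X][Y]) :=
    isUnit_C.2 (isUnit_C.2 (isUnit_iff_ne_zero.2 hc0))
  set t : ℂ[X][Y] := φ (C (C c) * A) with ht
  have ht' : t = C (C (GaussianInt.toComplex c)) * φ A := by
    rw [ht, map_mul, hφ, biMap_C_C]
  have hconj : conjPoly t = φ (C (C (gConj c)) * biMap gConj A) := by
    change biMap (starRingEnd ℂ) t = _
    rw [ht, hφ, ← biMap_toComplex_gConj, map_mul, biMap_C_C]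
  have hirrt : Irreducible t := by
    rw [ht', irreducible_isUnit_mul hcu]; exact hA.irreducible
  have hneg : negArgs t = conjPoly t := by
    change reflect ℂ t = _
    have hcc : (C (C (gConj c)) : GaussianInt[X][Y]) = C (C c) * (-1) ^ A.natDegree := by
      rw [← hc2]; simp
    rw [hconj, ht, hφ, reflect_biMap, map_mul, reflect_C_C, hA.reflect_eq, hcc, mul_assoc]
  have hmul : hPolyC k 2 = t * conjPoly t := by
    have hcc : (C (C c) * C (C (gConj c)) : GaussianInt[X][Y]) = 1 := by
      rw [← C_mul, ← C_mul, hc1]; simp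
    change biMap _ _ = _
    rw [← biMap_toComplex_toG, ← hA.mul_conj, hconj, ht, hφ, ← map_mul, mul_mul_mul_comm,
      hcc, one_mul]
  have hzt : zeroSet t = zeroSet (φ A) := by rw [ht', zeroSet_C_C_mul hc0]
  have hzc : toM3 '' zeroSet (conjPoly t) = toM3 '' zeroSet t := by
    rw [← hneg]; exact toM3_image_zeroSet_reflect t
  have himg : toM3 '' zeroSet (hPolyC k 2) = toM3 '' zeroSet (φ A) := by
    rw [hmul, zeroSet_mul, Set.image_union, hzc, Set.union_self, hzt]
  have h := sigmaCurve_eq hm hirr hd hlow (monic_biMap _ hA.monic) hA.irreducible himg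
  refine ⟨h.2.1, h.2.2, Or.inr ⟨t, hirrt, irreducible_biMap_conj hirrt,
    hasGaussianCoeffs_biMap _, hmul, hneg, ?_, ?_⟩⟩
  · rw [h.1, hzt]
  · rw [h.1, hzc, hzt]

/-! ### The case `k = 1` -/

/-- The polynomial `h_{1,2}`. -/
def sqAddOne : ℤ[X][Y] := (Y - C X) ^ 2 + 1

theorem monic_sqAddOne : sqAddOne.Monic ∧ sqAddOne.natDegree = 2 := by
  have h2 : ((Y - C X : ℤ[X][Y]) ^ 2).natDegree = 2 := by
    rw [natDegree_pow, natDegree_X_sub_C]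
  have hm2 : ((Y - C X : ℤ[X][Y]) ^ 2).Monic := (monic_X_sub_C _).pow 2
  have hlt : (1 : ℤ[X][Y]).degree < ((Y - C X : ℤ[X][Y]) ^ 2).degree := by
    rw [degree_one, degree_eq_natDegree hm2.ne_zero, h2]; norm_num
  exact ⟨hm2.add_of_left hlt, by rw [sqAddOne, natDegree_add_eq_left_of_degree_lt hlt, h2]⟩

theorem irreducible_sqAddOne : Irreducible sqAddOne := by
  obtain ⟨hm, hd⟩ := monic_sqAddOne
  rw [hm.irreducible_iff_roots_eq_zero_of_degree_le_three hd.ge (by omega)]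
  refine Multiset.eq_zero_of_forall_notMem fun r hr => ?_
  have hr' := isRoot_of_mem_roots hr
  have h : (r - X) ^ 2 + 1 = 0 := by simpa [sqAddOne, IsRoot] using hr'
  have h0 := congrArg (eval 0) h
  simp only [eval_add, eval_pow, eval_sub, eval_X, eval_one, eval_zero, sub_zero] at h0
  have := sq_nonneg (eval 0 r)
  omega

theorem lineEval_sqAddOne : lineEval gI (toG sqAddOne) = 0 := by
  have hC : (C gI : GaussianInt[X]) ^ 2 = -1 := by rw [← C_pow, gI_sq]; simp
  simp only [sqAddOne, map_add, map_sub, map_pow, map_one, biMap_C_X, biMap_Y, lineEval_C_X,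
    lineEval_Y]
  linear_combination hC

theorem gI_ne_zero : gI ≠ 0 := by
  intro h
  have := gI_sq
  rw [h] at this
  simp at this

theorem lineEval_fPoly_zero_one : lineEval gI (toG (fPoly 0 1)) = C gI := by
  rw [fPoly, zero_add, critIter_one, critIter_zero]
  simp

theorem sqAddOne_not_dvd {l m : ℕ} (h : IsLower 1 2 l m) : ¬ sqAddOne ∣ fPoly l m := by
  intro hd
  have hz : lineEval gI (toG (fPoly l m)) = 0 := by
    have := _root_.map_dvd ((lineEval gI).comp (biMap (Int.castRingHom GaussianInt))) hd
    change lineEval gI (toG sqAddOne) ∣ lineEval gI (toG (fPoly l m)) at this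
    rwa [lineEval_sqAddOne, zero_dvd_iff] at this
  rcases isLower_two h with ⟨rfl, hl⟩ | ⟨rfl, hl⟩
  · interval_cases l
    · rw [lineEval_fPoly_zero_one, C_eq_zero] at hz
      exact gI_ne_zero hz
    · have h1 := (lineEval_critIter gI_sq 0).1
      have h2 := (lineEval_critIter gI_sq 0).2
      simp only [mul_zero, zero_add] at h1 h2
      rw [fPoly, toG, map_sub, map_sub, h1, h2] at hz
      have := congrArg (eval 0) hz
      simp only [eval_sub, eval_mul, eval_add, eval_X, eval_C, mul_zero, zero_add, zero_sub,
        eval_zero, neg_eq_zero] at this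
      exact gI_ne_zero this
  · obtain rfl : l = 0 := by omega
    rw [fPoly_two, toG, map_mul, map_mul, lineEval_fPoly_zero_one,
      lineEval_perTwoQuot_zero gI_sq] at hz
    have hC : (C gI : GaussianInt[X]) ≠ 0 := C_ne_zero.2 gI_ne_zero
    exact mul_ne_zero hC (mul_ne_zero (by norm_num) (mul_ne_zero hC X_ne_zero)) hz

theorem perTwoQuot_one : perTwoQuot 1 = perTwoQuot 0 * perTwoQuot 0 * sqAddOne := by
  rw [perTwoQuot_succ 0, perTwoStep_zero, mul_assoc, sqAddOne]

theorem hPoly_one_two : hPoly 1 2 = sqAddOne := by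
  refine hPoly_eq (L := fPoly 1 1 * (perTwoQuot 0 * perTwoQuot 0))
    (by rw [fPoly_two, perTwoQuot_one]; ring) (fPoly_monic_natDegree 1 1).1 monic_sqAddOne.1
    irreducible_sqAddOne ?_ fun l m => sqAddOne_not_dvd
  intro g hg hd
  rcases hg.dvd_or_dvd hd with hd | hd
  · exact ⟨1, 1, ⟨le_rfl, le_rfl, one_dvd _, by simp⟩, hd⟩
  · have hd' : g ∣ perTwoQuot 0 := (hg.dvd_or_dvd hd).elim id id
    exact ⟨0, 2, ⟨by norm_num, by norm_num, dvd_rfl, by simp⟩,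
      hd'.trans (perTwoQuot_dvd_fPoly 0)⟩

theorem isConjFactor_sqAddOne : IsConjFactor sqAddOne (Y - C (X + C gI)) := by
  have hconj : biMap gConj (Y - C (X + C gI)) = Y - C (X - C gI) := by
    simp [gConj_gI, sub_eq_add_neg]
  refine ⟨monic_X_sub_C _, ?_, ?_, ?_⟩
  · have : biMap GaussianInt.toComplex (Y - C (X + C gI)) =
        Y - C (X + C (GaussianInt.toComplex gI)) := by simp
    rw [this]
    exact irreducible_X_sub_C _
  · have hI : (C (C gI) : GaussianInt[X][Y]) ^ 2 = -1 := by
      rw [← C_pow, ← C_pow, gI_sq]; simp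
    rw [hconj]
    simp only [sqAddOne, toG, map_add, map_sub, map_pow, map_one, biMap_C_X, biMap_Y]
    linear_combination -hI
  · rw [hconj, natDegree_X_sub_C, pow_one]
    simp only [map_sub, map_add, reflect_Y, reflect_C_X, reflect_C_C]
    ring

end CubicModuli

end

theorem theorem5 (k : ℕ) :
    IsIrreducible (CubicModuli.SigmaCurve k 2) ∧
    topologicalKrullDim (CubicModuli.SigmaCurve k 2) = 1 ∧
    (Irreducible (CubicModuli.hPolyC k 2) ∨
      ∃ t : ℂ[X][Y],
        Irreducible t ∧ Irreducible (CubicModuli.conjPoly t) ∧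
        CubicModuli.HasGaussianCoeffs t ∧
        CubicModuli.hPolyC k 2 = t * CubicModuli.conjPoly t ∧
        CubicModuli.negArgs t = CubicModuli.conjPoly t ∧
        CubicModuli.toM3 '' CubicModuli.zeroSet t = CubicModuli.SigmaCurve k 2 ∧
        CubicModuli.toM3 '' CubicModuli.zeroSet (CubicModuli.conjPoly t) =
          CubicModuli.SigmaCurve k 2) := by
  by_cases hk : k = 1
  · subst hk
    exact CubicModuli.sigmaCurve_two CubicModuli.hPoly_one_two CubicModuli.monic_sqAddOne.1
      CubicModuli.irreducible_sqAddOne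
      ((Dvd.intro_left _ CubicModuli.perTwoQuot_one.symm).trans
        (CubicModuli.perTwoQuot_dvd_fPoly 1))
      (fun l m => CubicModuli.sqAddOne_not_dvd) (Or.inr ⟨_, CubicModuli.isConjFactor_sqAddOne⟩)
  · obtain ⟨H, hH⟩ := CubicModuli.exists_isCore hk
    exact CubicModuli.sigmaCurve_two hH.hPoly_two hH.monic hH.irreducible
      (hH.dvd_perTwoQuot.trans (CubicModuli.perTwoQuot_dvd_fPoly k))
      (fun l m => hH.not_dvd_fPoly) hH.irreducible_or_exists_isConjFactor
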